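/- Let $X_*,Y_*$ be real functions analytic near $(0,0)$ and $p$ a real function analytic near $0$ with $p(0)=p'(0)=0$, and suppose that the origin is an isolated nilpotent singularity (the linear part is nilpotent and nonzero) of the planar system $$\dot x=yX_*(x,y),\qquad \dot y=p(x)+yY_*(x,y).$$ Let $y=f(x)$, $f(0)=0$, $f\in C^1$, be its characteristic curve near the origin, i.e. the curve on which $\dot x=0$; let $U=(U_1,U_2)$ be the unit-time map of the system near the origin, and let $C_h(x)=U_1(x,f(x))$ be the characteristic map. The origin is called an $m$-multiple singular point if $\dot y=ax^m+O(x^{m+1})$ with $a\neq0$ on the characteristic curve, and an $m$-multiple node if it is in addition a node (all trajectories starting near the origin stay near it and tend to it, each nonzero one in a definite direction, either all in forward or all in backward time). The characteristic box dimension $\dim_{ch}U$ is the common box dimension of the orbits, with nonzero starting point, that are generated by $C_h$ (or, on a side of $0$ where $C_h$ is repelling, by its local inverse) in a sufficiently small neighbourhood of $0$. Then the unit-time map and the characteristic map exist near the origin, and for some integer $m\ge 2$ and some $c\neq 0$ $$C_h(x)=x+\tfrac c2x^m+O(x^{m+1}),\qquad \dim_{ch}U=1-\tfrac1m .$$ Moreover,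 for every integer $m\ge1$ the following are equivalent: (a) $C_h(x)=x+\frac c2x^m+O(x^{m+1})$ for some $c\ne0$; (b) $\dim_{ch}U=1-\frac1m$; (c) the origin is an $m$-multiple singular point. In particular, if the origin is a node, then each of (a) and (b) holds if and only if the origin is an $m$-multiple node; in this case $\dim_{ch}U$ in (b) may be taken as the box dimension of the forward orbits of $C_h$ alone. -/

import Mathlib

open Set Filter Topology MeasureTheory Asymptotics

noncomputable section

namespace NilpotentDim

/-! ### Box dimension of a bounded subset of the line (ambient dimension `N = 1`) -/

/-- The lower `s`-dimensional Minkowski content of `A ⊆ ℝ`. -/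
def lowerMinkowskiContent (s : ℝ) (A : Set ℝ) : ENNReal :=
  liminf (fun ε : ℝ => volume (Metric.thickening ε A) / ENNReal.ofReal (ε ^ (1 - s))) (𝓝[>] 0)

/-- The upper `s`-dimensional Minkowski content of `A ⊆ ℝ`. -/
def upperMinkowskiContent (s : ℝ) (A : Set ℝ) : ENNReal :=
  limsup (fun ε : ℝ => volume (Metric.thickening ε A) / ENNReal.ofReal (ε ^ (1 - s))) (𝓝[>] 0)

/-- Lower box dimension. -/
def lowerBoxDim (A : Set ℝ) : ℝ := sInf {s : ℝ | 0 < s ∧ lowerMinkowskiContent s A = 0}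

/-- Upper box dimension. -/
def upperBoxDim (A : Set ℝ) : ℝ := sInf {s : ℝ | 0 < s ∧ upperMinkowskiContent s A = 0}

/-- `A` is bounded and its box dimension exists and equals `d`. -/
def HasBoxDim (A : Set ℝ) (d : ℝ) : Prop :=
  Bornology.IsBounded A ∧ lowerBoxDim A = d ∧ upperBoxDim A = d

/-! ### Planar vector fields near the origin

Only the germ at the origin of a vector field `V : ℝ × ℝ → ℝ × ℝ` matters below. -/

/-- `γ` is a solution of `ż = V z` on the time set `I` that stays in `W`. -/
def IsSolutionIn (V : ℝ × ℝ → ℝ × ℝ) (W : Set (ℝ × ℝ)) (I : Set ℝ) (γ : ℝ → ℝ × ℝ) : Prop :=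
  ∀ t ∈ I, γ t ∈ W ∧ HasDerivWithinAt γ (V (γ t)) I t

/-- The origin is a singular point of `V` whose linear part is nilpotent and nonzero. -/
def IsNilpotentSingularity (V : ℝ × ℝ → ℝ × ℝ) : Prop :=
  V 0 = 0 ∧ DifferentiableAt ℝ V 0 ∧ IsNilpotent (fderiv ℝ V 0) ∧ fderiv ℝ V 0 ≠ 0

/-- No point of a punctured neighbourhood of the origin is singular. -/
def IsIsolatedSingularity (V : ℝ × ℝ → ℝ × ℝ) : Prop :=
  V 0 = 0 ∧ ∀ᶠ z in 𝓝[≠] (0 : ℝ × ℝ), V z ≠ 0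

/-- `U` is (near the origin) the unit-time map of `ż = V z`: trajectories that start close to the
origin exist on `[0, 1]`, remain close to the origin, and `U` sends their initial point to their
point at time `1`. -/
def IsUnitTimeMap (V U : ℝ × ℝ → ℝ × ℝ) : Prop :=
  ∀ W ∈ 𝓝 (0 : ℝ × ℝ), ∀ᶠ z in 𝓝 (0 : ℝ × ℝ),
    ∃ γ : ℝ → ℝ × ℝ, γ 0 = z ∧ γ 1 = U z ∧ IsSolutionIn V W (Icc 0 1) γ

/-- `y = f x` is (near the origin) the characteristic curve of `V`: the first component of `V`
vanishes on it and it passes through the origin. -/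
def IsCharacteristicCurve (V : ℝ × ℝ → ℝ × ℝ) (f : ℝ → ℝ) : Prop :=
  f 0 = 0 ∧ ContDiffAt ℝ 1 f 0 ∧ ∀ᶠ x in 𝓝 (0 : ℝ), (V (x, f x)).1 = 0

/-- The origin is an `m`-multiple singular point: on the characteristic curve the second component
of `V` is `a x ^ m + O(x ^ (m + 1))` with `a ≠ 0`. -/
def IsMultipleSingularity (V : ℝ × ℝ → ℝ × ℝ) (m : ℕ) : Prop :=
  V 0 = 0 ∧ ∃ f : ℝ → ℝ, IsCharacteristicCurve V f ∧ ∃ a : ℝ, a ≠ 0 ∧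
    (fun x : ℝ => (V (x, f x)).2 - a * x ^ m) =O[𝓝 0] (fun x : ℝ => x ^ (m + 1))

/-- The origin is a stable (attracting) node: trajectories that start near the origin stay near it,
tend to it, and (unless they start at the origin) do so in a definite direction. -/
def IsStableNode (V : ℝ × ℝ → ℝ × ℝ) : Prop :=
  ∀ W ∈ 𝓝 (0 : ℝ × ℝ), ∀ᶠ z in 𝓝 (0 : ℝ × ℝ),
    ∃ γ : ℝ → ℝ × ℝ, γ 0 = z ∧ IsSolutionIn V W (Ici 0) γ ∧ Tendsto γ atTop (𝓝 0) ∧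
      (z ≠ 0 → ∃ v : ℝ × ℝ, Tendsto (fun t => ‖γ t‖⁻¹ • γ t) atTop (𝓝 v))

/-- The origin is an isolated singular point that is a stable or an unstable node. -/
def IsNode (V : ℝ × ℝ → ℝ × ℝ) : Prop :=
  IsIsolatedSingularity V ∧ (IsStableNode V ∨ IsStableNode (fun z => -V z))

/-- The origin is an `m`-multiple node. -/
def IsMultipleNode (V : ℝ × ℝ → ℝ × ℝ) (m : ℕ) : Prop :=
  IsNode V ∧ IsMultipleSingularity V m

/-! ### Characteristic map and characteristic box dimension -/

/-- `C` is (near `0`) the characteristic map: the first component of the unit-time map, restricted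
to the characteristic curve. -/
def IsCharacteristicMap (V : ℝ × ℝ → ℝ × ℝ) (C : ℝ → ℝ) : Prop :=
  ∃ (f : ℝ → ℝ) (U : ℝ × ℝ → ℝ × ℝ), IsCharacteristicCurve V f ∧ IsUnitTimeMap V U ∧
    ∀ᶠ x in 𝓝 (0 : ℝ), C x = (U (x, f x)).1

/-- `C x = x + (c / 2) x ^ m + O(x ^ (m + 1))` as `x → 0`. -/
def HasExpansion (C : ℝ → ℝ) (c : ℝ) (m : ℕ) : Prop :=
  (fun x : ℝ => C x - (x + c / 2 * x ^ m)) =O[𝓝 0] (fun x : ℝ => x ^ (m + 1))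

/-- Forward version: every orbit `x₀, C x₀, C (C x₀), …` with `x₀ ≠ 0` close to `0` stays close
to `0` and has box dimension `d`. -/
def HasForwardCharBoxDim (C : ℝ → ℝ) (d : ℝ) : Prop :=
  ∃ δ > 0, ∀ x₀ : ℝ, x₀ ≠ 0 → |x₀| < δ →
    (∀ k : ℕ, |C^[k] x₀| < δ) ∧ HasBoxDim (range fun k : ℕ => C^[k] x₀) d

/-- `s` is an infinite orbit of `C` or of the local inverse of `C`, contained in `(-δ, δ)`. -/
def IsLocalOrbit (C : ℝ → ℝ) (δ : ℝ) (s : ℕ → ℝ) : Prop :=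
  (∀ k, |s k| < δ) ∧ ((∀ k, s (k + 1) = C (s k)) ∨ ∀ k, C (s (k + 1)) = s k)

/-- General version, which also covers points from which forward orbits leave a neighbourhood
of `0`: every `x₀ ≠ 0` close to `0` starts an orbit of `C` or of its local inverse that stays close
to `0`, and each such orbit has box dimension `d`. -/
def HasCharBoxDim (C : ℝ → ℝ) (d : ℝ) : Prop :=
  ∃ δ > 0, ∀ x₀ : ℝ, x₀ ≠ 0 → |x₀| < δ →
    (∃ s : ℕ → ℝ, s 0 = x₀ ∧ IsLocalOrbit C δ s) ∧
      ∀ s : ℕ → ℝ, s 0 = x₀ → IsLocalOrbit C δ s → HasBoxDim (range s) d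

/-- The vector field `ẋ = y X(x, y)`, `ẏ = p(x) + y Y(x, y)`. -/
def system (X Y : ℝ × ℝ → ℝ) (p : ℝ → ℝ) (z : ℝ × ℝ) : ℝ × ℝ :=
  (z.2 * X z, p z.1 + z.2 * Y z)

end NilpotentDim

end

namespace NilpotentDim

/-! The linear part at the origin is `v ↦ v₂ • (X 0, Y 0)`. Being nilpotent and nonzero, it forces
`Y 0 = 0` and `X 0 ≠ 0`, so near the origin the characteristic curve is the axis `y = 0`, where `ẏ =
p x`. Isolatedness prevents `p` from vanishing identically, so `p x = x ^ m₀ * g x` with `g 0 ≠ 0`,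
and `m₀ ≥ 2` because `p` and its derivative vanish at `0`.

Along the trajectory from `(x, 0)`, to leading order, `y` grows like `p x * t` and the first
coordinate like `x + X 0 * p x * t ^ 2 / 2`, with errors `O(x * p x)` (`isBigO_unitTimeMap_fst`). At
`t = 1` this is the expansion of the characteristic map with `m = m₀` and `c = X 0 * g 0`.

Such a map moves points by an amount comparable to `|x| ^ m₀`, and a positive sequence with gaps of
that size has box dimension `1 - 1 / m₀` (`hasBoxDim_range_of_decay`); inverse orbits serve on a
repelling side. Since an expansion, a dimension and a multiplicity each determine the exponent,
every condition reduces to `m = m₀`.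

At a node neither half-axis can be repelling (`IsNode.leadingCoeff_neg`), so forward orbits suffice.
-/

/-! ### Box dimension from the volume of thickenings. -/

theorem hasBoxDim_of_volume_bounds {A : Set ℝ} {d a b : ℝ} (hA : Bornology.IsBounded A)
    (hd : 0 < d) (ha : 0 < a) (hb : 0 < b)
    (hlo : ∀ᶠ ε in 𝓝[>] (0 : ℝ),
      ENNReal.ofReal (a * ε ^ (1 - d)) ≤ volume (Metric.thickening ε A))
    (hhi : ∀ᶠ ε in 𝓝[>] (0 : ℝ),
      volume (Metric.thickening ε A) ≤ ENNReal.ofReal (b * ε ^ (1 - d))) :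
    HasBoxDim A d := by
  have hsplit : ∀ (s ε : ℝ), 0 < ε → ε ^ (1 - d) = ε ^ (s - d) * ε ^ (1 - s) := by
    intro s ε hε
    rw [← Real.rpow_add hε]; congr 1; ring
  have hupper : ∀ s, d < s → upperMinkowskiContent s A = 0 := by
    intro s hs
    apply Tendsto.limsup_eq
    have h0 : Tendsto (fun ε : ℝ => ENNReal.ofReal (b * ε ^ (s - d))) (𝓝[>] 0) (𝓝 0) := by
      have : Tendsto (fun ε : ℝ => b * ε ^ (s - d)) (𝓝[>] 0) (𝓝 0) := by
        have hc : ContinuousAt (fun ε : ℝ => b * ε ^ (s - d)) 0 :=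
          (Real.continuousAt_rpow_const _ _ (Or.inr (by linarith))).const_mul b
        have := hc.tendsto.mono_left (nhdsWithin_le_nhds (s := Ioi 0))
        simpa [Real.zero_rpow (by linarith : s - d ≠ 0)] using this
      simpa using ENNReal.tendsto_ofReal this
    refine tendsto_of_tendsto_of_tendsto_of_le_of_le' tendsto_const_nhds h0
      (Eventually.of_forall fun _ => zero_le) ?_
    filter_upwards [hhi, self_mem_nhdsWithin] with ε h hε
    have hε : 0 < ε := hε
    have hp : 0 < ε ^ (1 - s) := Real.rpow_pos_of_pos hε _
    refine ENNReal.div_le_of_le_mul (h.trans_eq ?_)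
    rw [← ENNReal.ofReal_mul (by positivity), hsplit s ε hε, mul_assoc]
  have hlower : ∀ s, s ≤ d → lowerMinkowskiContent s A ≠ 0 := by
    intro s hs
    have : ENNReal.ofReal a ≤ lowerMinkowskiContent s A := by
      refine le_liminf_of_le (by isBoundedDefault) ?_
      filter_upwards [hlo, self_mem_nhdsWithin,
        mem_nhdsWithin_of_mem_nhds (Iio_mem_nhds one_pos)] with ε h hε hε1
      have hε : 0 < ε := hε
      have hε1 : ε < 1 := hε1
      have hp : 0 < ε ^ (1 - s) := Real.rpow_pos_of_pos hε _
      rw [ENNReal.le_div_iff_mul_le (Or.inl (by simpa using hp)) (Or.inl ENNReal.ofReal_ne_top),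
        ← ENNReal.ofReal_mul ha.le]
      refine le_trans (ENNReal.ofReal_le_ofReal ?_) h
      exact mul_le_mul_of_nonneg_left
        (Real.rpow_le_rpow_of_exponent_ge hε hε1.le (by linarith)) ha.le
    intro h0
    rw [h0] at this
    exact absurd this (not_le.2 (ENNReal.ofReal_pos.2 ha))
  have hle : ∀ s, lowerMinkowskiContent s A ≤ upperMinkowskiContent s A :=
    fun s => liminf_le_limsup
  refine ⟨hA, ?_, ?_⟩
  · have : {s : ℝ | 0 < s ∧ lowerMinkowskiContent s A = 0} = Ioi d := by
      ext s
      refine ⟨fun h => not_le.1 fun hs => hlower s hs h.2, fun h => ⟨hd.trans h, ?_⟩⟩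
      exact le_antisymm ((hle s).trans_eq (hupper s h)) zero_le
    rw [lowerBoxDim, this, csInf_Ioi]
  · have : {s : ℝ | 0 < s ∧ upperMinkowskiContent s A = 0} = Ioi d := by
      ext s
      refine ⟨fun h => not_le.1 fun hs => hlower s hs ?_, fun h => ⟨hd.trans h, hupper s h⟩⟩
      exact le_antisymm ((hle s).trans_eq h.2) zero_le
    rw [upperBoxDim, this, csInf_Ioi]

theorem HasBoxDim.neg {A : Set ℝ} {d : ℝ} (h : HasBoxDim A d) : HasBoxDim (-A) d := by
  have hv : ∀ ε, volume (Metric.thickening ε (-A)) = volume (Metric.thickening ε A) := by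
    intro ε
    rw [← Measure.measure_neg volume (Metric.thickening ε A)]
    congr 1
    ext x
    simp only [Metric.mem_thickening_iff, Set.mem_neg]
    constructor
    · rintro ⟨z, hz, hx⟩
      exact ⟨-z, hz, by rwa [dist_neg_neg]⟩
    · rintro ⟨z, hz, hx⟩
      exact ⟨-z, by simpa using hz, by rwa [← dist_neg_neg, neg_neg]⟩
  obtain ⟨h1, h2, h3⟩ := h
  refine ⟨?_, ?_, ?_⟩
  · exact h1.neg
  · simpa only [lowerBoxDim, lowerMinkowskiContent, hv] using h2
  · simpa only [upperBoxDim, upperMinkowskiContent, hv] using h3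

theorem HasBoxDim.unique {A : Set ℝ} {d d' : ℝ} (h : HasBoxDim A d) (h' : HasBoxDim A d') :
    d = d' := h.2.1.symm.trans h'.2.1

/-! ### Box dimension of sequences with power-law gaps. -/

section Sequence

variable {s : ℕ → ℝ} {m : ℕ} {A B : ℝ}

/-- Discrete form of integrating `s' = -A s ^ m`: each step raises `(s k ^ (m - 1))⁻¹` by at least
`A`. -/
theorem mul_le_inv_pow_of_decay (hm : 2 ≤ m) (hpos : ∀ k, 0 < s k) (hA : 0 < A)
    (hlo : ∀ k, A * s k ^ m ≤ s k - s (k + 1)) (k : ℕ) : A * k ≤ (s k ^ (m - 1))⁻¹ := by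
  obtain ⟨n, rfl⟩ : ∃ n, m = n + 2 := ⟨m - 2, by omega⟩
  simp only [show n + 2 - 1 = n + 1 by omega]
  induction k with
  | zero => simpa using (pow_pos (hpos 0) _).le
  | succ k ih =>
    have h1 := hpos k
    have h2 := hpos (k + 1)
    have h3 := hlo k
    have h4 : s (k + 1) ≤ s k := by nlinarith [pow_pos h1 (n + 2)]
    have key : A ≤ (s (k + 1) ^ (n + 1))⁻¹ - (s k ^ (n + 1))⁻¹ := by
      rw [inv_sub_inv (by positivity) (by positivity), le_div_iff₀ (by positivity)]
      have h5 : s (k + 1) ^ n ≤ s k ^ n := pow_le_pow_left₀ h2.le h4 n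
      calc A * (s (k + 1) ^ (n + 1) * s k ^ (n + 1))
          ≤ A * (s k ^ (n + 1) * s k ^ (n + 1)) := by gcongr
        _ = s k ^ n * (A * s k ^ (n + 2)) := by ring
        _ ≤ s k ^ n * (s k - s (k + 1)) := by gcongr
        _ ≤ s k ^ (n + 1) - s (k + 1) ^ (n + 1) := by
          have : s (k + 1) ^ n * s (k + 1) ≤ s k ^ n * s (k + 1) := by gcongr
          rw [pow_succ, pow_succ]; linarith
    push_cast
    linarith

theorem exists_lt_of_decay (hm : 2 ≤ m) (hpos : ∀ k, 0 < s k) (hA : 0 < A)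
    (hlo : ∀ k, A * s k ^ m ≤ s k - s (k + 1)) {t : ℝ} (ht : 0 < t) : ∃ k, s k < t := by
  obtain ⟨k, hk⟩ := exists_nat_gt ((t ^ (m - 1))⁻¹ / A)
  refine ⟨k, not_le.1 fun h => ?_⟩
  have h1 := mul_le_inv_pow_of_decay hm hpos hA hlo k
  have h2 : (s k ^ (m - 1))⁻¹ ≤ (t ^ (m - 1))⁻¹ := by gcongr
  rw [div_lt_iff₀ hA] at hk
  linarith

/-- With `ε = ρ ^ m`, the terms below `ρ` have their neighbourhoods inside one interval of length `ρ
+ 2 * ε`, while the at most `(ρ ^ (m - 1))⁻¹ / A + 1` others contribute `2 * ε` each; both parts are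
`O(ρ)`. -/
theorem volume_thickening_range_le (hm : 2 ≤ m) (hpos : ∀ k, 0 < s k) (hA : 0 < A)
    (hlo : ∀ k, A * s k ^ m ≤ s k - s (k + 1)) {ρ : ℝ} (hρ : 0 < ρ) (hρ1 : ρ < 1) :
    volume (Metric.thickening (ρ ^ m) (range s)) ≤ ENNReal.ofReal ((5 + 2 / A) * ρ) := by
  set ε := ρ ^ m with hε
  have hε0 : 0 < ε := by positivity
  have hερ : ε ≤ ρ := pow_le_of_le_one hρ.le hρ1.le (by omega)
  set N := ⌊(ρ ^ (m - 1))⁻¹ / A⌋₊ + 1 with hN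
  have hsub : Metric.thickening ε (range s) ⊆
      Ioo (-ε) (ρ + ε) ∪ ⋃ k ∈ Finset.range N, Metric.ball (s k) ε := by
    intro x hx
    rw [Metric.mem_thickening_iff] at hx
    obtain ⟨_, ⟨k, rfl⟩, hk⟩ := hx
    rw [Real.dist_eq, abs_lt] at hk
    by_cases h : s k < ρ
    · left
      have := hpos k
      exact ⟨by linarith, by linarith⟩
    · right
      push Not at h
      simp only [mem_iUnion, Finset.mem_range]
      refine ⟨k, ?_, by rw [Metric.mem_ball, Real.dist_eq, abs_lt]; exact hk⟩
      have h1 := mul_le_inv_pow_of_decay hm hpos hA hlo k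
      have h2 : (s k ^ (m - 1))⁻¹ ≤ (ρ ^ (m - 1))⁻¹ := by gcongr
      rw [hN, Nat.lt_succ_iff]
      apply Nat.le_floor
      rw [le_div_iff₀ hA]
      linarith
  have hNle : (N : ℝ) ≤ (ρ ^ (m - 1))⁻¹ / A + 1 := by
    rw [hN]; push_cast
    have := Nat.floor_le (a := (ρ ^ (m - 1))⁻¹ / A) (by positivity)
    linarith
  have hεs : ε * (ρ ^ (m - 1))⁻¹ = ρ := by
    rw [hε]
    nth_rw 1 [show m = (m - 1) + 1 by omega]
    rw [pow_succ]; field_simp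
  calc volume (Metric.thickening ε (range s))
      ≤ volume (Ioo (-ε) (ρ + ε)) + volume (⋃ k ∈ Finset.range N, Metric.ball (s k) ε) :=
        (measure_mono hsub).trans (measure_union_le _ _)
    _ ≤ ENNReal.ofReal (ρ + 2 * ε) + ∑ k ∈ Finset.range N, ENNReal.ofReal (2 * ε) := by
        gcongr
        · rw [Real.volume_Ioo]; apply ENNReal.ofReal_le_ofReal; linarith
        · refine (measure_biUnion_finset_le _ _).trans (Finset.sum_le_sum fun k _ => ?_)
          rw [Real.volume_ball]
    _ = ENNReal.ofReal (ρ + 2 * ε + N * (2 * ε)) := by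
        rw [Finset.sum_const, Finset.card_range, nsmul_eq_mul,
          ENNReal.ofReal_add (p := ρ + 2 * ε) (by positivity) (by positivity),
          ENNReal.ofReal_mul (p := (N : ℝ)) (by positivity), ENNReal.ofReal_natCast]
    _ ≤ ENNReal.ofReal ((5 + 2 / A) * ρ) := by
        apply ENNReal.ofReal_le_ofReal
        have h1 : (N : ℝ) * (2 * ε) ≤ ((ρ ^ (m - 1))⁻¹ / A + 1) * (2 * ε) := by gcongr
        have h2 : ((ρ ^ (m - 1))⁻¹ / A + 1) * (2 * ε) = 2 / A * ρ + 2 * ε := by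
          calc _ = 2 / A * (ε * (ρ ^ (m - 1))⁻¹) + 2 * ε := by ring
            _ = _ := by rw [hεs]
        linarith

/-- Near `0` the terms are denser than `ρ ^ m`: a point `t` of the interval is within that distance
of the first term below it. `hhalf` accounts for the factor `2` in the constant, and `B + 1` absorbs
the gap constant. -/
theorem le_volume_thickening_range (hm : 2 ≤ m) (hpos : ∀ k, 0 < s k) (hA : 0 < A) (hB : 0 < B)
    (hlo : ∀ k, A * s k ^ m ≤ s k - s (k + 1)) (hhi : ∀ k, s k - s (k + 1) ≤ B * s k ^ m)
    (hhalf : ∀ k, s k ≤ 2 * s (k + 1)) {ρ : ℝ} (hρ : 0 < ρ) (hρ0 : ρ < s 0) :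
    ENNReal.ofReal ((2 * (B + 1))⁻¹ * ρ) ≤ volume (Metric.thickening (ρ ^ m) (range s)) := by
  have hsub : Ioo 0 ((2 * (B + 1))⁻¹ * ρ) ⊆ Metric.thickening (ρ ^ m) (range s) := by
    rintro t ⟨ht0, ht⟩
    have hex := exists_lt_of_decay hm hpos hA hlo ht0
    classical
    have hκ : (2 * (B + 1))⁻¹ ≤ 1 := inv_le_one_of_one_le₀ (by linarith)
    -- This makes the first index with `s k < t` a successor, so a preceding term exists.
    have hts : t < s 0 := by nlinarith
    obtain ⟨k, hk⟩ : ∃ k, Nat.find hex = k + 1 := by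
      refine Nat.exists_eq_succ_of_ne_zero fun h => ?_
      have := Nat.find_spec hex
      rw [h] at this
      linarith
    have h1 : s (k + 1) < t := hk ▸ Nat.find_spec hex
    have h2 : t ≤ s k := not_lt.1 (Nat.find_min hex (by omega))
    refine Metric.mem_thickening_iff.2 ⟨s (k + 1), mem_range_self _, ?_⟩
    rw [Real.dist_eq, abs_of_pos (by linarith)]
    have hk0 := hpos k
    have h3 : s k < (B + 1)⁻¹ * ρ := by
      have : (2 * (B + 1))⁻¹ * ρ = (B + 1)⁻¹ * ρ / 2 := by rw [mul_inv]; ring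
      have := hhalf k
      linarith
    have h4 : s k ^ m < ((B + 1)⁻¹ * ρ) ^ m := pow_lt_pow_left₀ h3 hk0.le (by omega)
    have h5 : ((B + 1)⁻¹) ^ m ≤ (B + 1)⁻¹ :=
      pow_le_of_le_one (by positivity) (inv_le_one_of_one_le₀ (by linarith)) (by omega)
    have hρm : 0 < ρ ^ m := by positivity
    calc t - s (k + 1) ≤ s k - s (k + 1) := by linarith
      _ ≤ B * s k ^ m := hhi k
      _ < B * ((B + 1)⁻¹ * ρ) ^ m := by gcongr
      _ ≤ B * ((B + 1)⁻¹ * ρ ^ m) := by rw [mul_pow]; gcongr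
      _ = B / (B + 1) * ρ ^ m := by ring
      _ ≤ 1 * ρ ^ m := by
        gcongr
        rw [div_le_one (by linarith)]; linarith
      _ = ρ ^ m := one_mul _
  refine le_trans ?_ (measure_mono hsub)
  rw [Real.volume_Ioo, sub_zero]

/-- A positive sequence whose consecutive gaps are comparable with the `m`-th power of its terms
has box dimension `1 - 1 / m`. -/
theorem hasBoxDim_range_of_decay (hm : 2 ≤ m) (hpos : ∀ k, 0 < s k) (hA : 0 < A) (hB : 0 < B)
    (hlo : ∀ k, A * s k ^ m ≤ s k - s (k + 1)) (hhi : ∀ k, s k - s (k + 1) ≤ B * s k ^ m)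
    (hhalf : ∀ k, s k ≤ 2 * s (k + 1)) : HasBoxDim (range s) (1 - 1 / (m : ℝ)) := by
  have hm' : (2 : ℝ) ≤ m := by exact_mod_cast hm
  have hanti : Antitone s := antitone_nat_of_succ_le fun k => by
    have := hlo k
    have := pow_pos (hpos k) m
    nlinarith
  have hroot : Tendsto (fun ε : ℝ => ε ^ (1 / (m : ℝ))) (𝓝[>] 0) (𝓝 0) := by
    have hc : ContinuousAt (fun ε : ℝ => ε ^ (1 / (m : ℝ))) 0 :=
      Real.continuousAt_rpow_const _ _ (Or.inr (by positivity))
    have := hc.tendsto.mono_left (nhdsWithin_le_nhds (s := Ioi 0))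
    rwa [Real.zero_rpow (by positivity)] at this
  -- The volume bounds are used with `ρ = ε ^ (1 / m)`, which is exactly `ε ^ (1 - d)` for `d = 1 -
  -- 1 / m`.
  have hpow : ∀ ε : ℝ, 0 < ε → (ε ^ (1 / (m : ℝ))) ^ m = ε := fun ε hε => by
    rw [one_div, Real.rpow_inv_natCast_pow hε.le (by omega)]
  refine hasBoxDim_of_volume_bounds (a := (2 * (B + 1))⁻¹) (b := 5 + 2 / A) ?_ ?_ (by positivity)
    (by positivity) ?_ ?_
  · refine (Metric.isBounded_Icc 0 (s 0)).subset ?_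
    rintro _ ⟨k, rfl⟩
    exact ⟨(hpos k).le, hanti (Nat.zero_le k)⟩
  · have : 1 / (m : ℝ) ≤ 1 / 2 := by gcongr
    linarith
  · filter_upwards [self_mem_nhdsWithin, hroot.eventually (Iio_mem_nhds (hpos 0))] with ε hε h0
    have := le_volume_thickening_range hm hpos hA hB hlo hhi hhalf
      (Real.rpow_pos_of_pos hε (1 / (m : ℝ))) h0
    rw [hpow ε hε] at this
    rwa [sub_sub_cancel]
  · filter_upwards [self_mem_nhdsWithin, hroot.eventually (Iio_mem_nhds one_pos)] with ε hε h0
    have := volume_thickening_range_le hm hpos hA hlo (Real.rpow_pos_of_pos hε (1 / (m : ℝ))) h0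
    rw [hpow ε hε] at this
    rwa [sub_sub_cancel]

end Sequence

/-! ### Uniqueness of leading exponents and of dimensions. -/

theorem leadingOrder_unique {g : ℝ → ℝ} {a b : ℝ} {m n : ℕ} (ha : a ≠ 0) (hb : b ≠ 0)
    (hm : (fun x => g x - a * x ^ m) =O[𝓝 0] fun x : ℝ => x ^ (m + 1))
    (hn : (fun x => g x - b * x ^ n) =O[𝓝 0] fun x : ℝ => x ^ (n + 1)) : m = n := by
  have key : ∀ {a b : ℝ} {m n : ℕ}, a ≠ 0 →
      ((fun x => g x - a * x ^ m) =O[𝓝 0] fun x : ℝ => x ^ (m + 1)) →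
      ((fun x => g x - b * x ^ n) =O[𝓝 0] fun x : ℝ => x ^ (n + 1)) → ¬ m < n := by
    intro a b m n ha hm hn hlt
    have h1 : (fun x => g x - a * x ^ m) =o[𝓝 0] fun x : ℝ => x ^ m :=
      hm.trans_isLittleO (isLittleO_pow_pow (by omega))
    have h2 : (fun x => g x - b * x ^ n) =o[𝓝 0] fun x : ℝ => x ^ m :=
      hn.trans_isLittleO (isLittleO_pow_pow (by omega))
    have h3 : (fun x : ℝ => b * x ^ n) =o[𝓝 0] fun x : ℝ => x ^ m :=
      (isLittleO_pow_pow hlt).const_mul_left b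
    have h4 : (fun x : ℝ => a * x ^ m) =o[𝓝 0] fun x : ℝ => x ^ m :=
      ((h2.add h3).sub h1).congr_left fun x => by ring
    have h5 : (fun x : ℝ => x ^ m) =o[𝓝 0] fun x : ℝ => x ^ m :=
      (isLittleO_const_mul_left_iff ha).1 h4
    refine isLittleO_irrefl ?_ h5
    have : ∃ᶠ x in 𝓝[≠] (0 : ℝ), x ^ m ≠ 0 :=
      Eventually.frequently
        (eventually_nhdsWithin_of_forall fun (x : ℝ) (hx : x ∈ ({0}ᶜ : Set ℝ)) => pow_ne_zero m hx)
    exact this.filter_mono nhdsWithin_le_nhds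
  have h1 := key ha hm hn
  have h2 := key hb hn hm
  omega

/-- A local orbit for the smaller radius is also one for the larger, so both dimensions apply to the
same set. -/
theorem HasCharBoxDim.unique {C : ℝ → ℝ} {d d' : ℝ} (h : HasCharBoxDim C d)
    (h' : HasCharBoxDim C d') : d = d' := by
  have key : ∀ {d d' δ δ' : ℝ}, 0 < δ → δ ≤ δ' →
      (∀ x₀ : ℝ, x₀ ≠ 0 → |x₀| < δ → (∃ s : ℕ → ℝ, s 0 = x₀ ∧ IsLocalOrbit C δ s) ∧
        ∀ s : ℕ → ℝ, s 0 = x₀ → IsLocalOrbit C δ s → HasBoxDim (range s) d) →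
      (∀ x₀ : ℝ, x₀ ≠ 0 → |x₀| < δ' → (∃ s : ℕ → ℝ, s 0 = x₀ ∧ IsLocalOrbit C δ' s) ∧
        ∀ s : ℕ → ℝ, s 0 = x₀ → IsLocalOrbit C δ' s → HasBoxDim (range s) d') → d = d' := by
    intro d d' δ δ' hδ hle h h'
    have hx : |δ / 2| < δ := by rw [abs_of_pos (by linarith)]; linarith
    obtain ⟨⟨s, hs0, hs⟩, hall⟩ := h (δ / 2) (by positivity) hx
    exact (hall s hs0 hs).unique ((h' (δ / 2) (by positivity) (hx.trans_le hle)).2 s hs0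
      ⟨fun k => (hs.1 k).trans_le hle, hs.2⟩)
  obtain ⟨δ, hδ, h⟩ := h
  obtain ⟨δ', hδ', h'⟩ := h'
  rcases le_total δ δ' with hle | hle
  · exact key hδ hle h h'
  · exact (key hδ' hle h' h).symm

theorem HasForwardCharBoxDim.unique {C : ℝ → ℝ} {d d' : ℝ} (h : HasForwardCharBoxDim C d)
    (h' : HasForwardCharBoxDim C d') : d = d' := by
  obtain ⟨δ, hδ, h⟩ := h
  obtain ⟨δ', hδ', h'⟩ := h'
  have hpos : 0 < min δ δ' := lt_min hδ hδ'
  have hx : |min δ δ' / 2| < min δ δ' := by rw [abs_of_pos (by linarith)]; linarith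
  exact (h _ (by positivity) (hx.trans_le (min_le_left _ _))).2.unique
    (h' _ (by positivity) (hx.trans_le (min_le_right _ _))).2

/-! ### Orbits of a map `x + (c / 2) x ^ m + …`. -/

theorem not_bddAbove_of_growth {s : ℕ → ℝ} {η δ : ℝ} (hη : 0 < η)
    (h : ∀ k, s k + η ≤ s (k + 1)) (hδ : ∀ k, s k < δ) : False := by
  have hk : ∀ k : ℕ, s 0 + k * η ≤ s k := by
    intro k
    induction k with
    | zero => simp
    | succ k ih => have := h k; push_cast; linarith
  obtain ⟨k, hk'⟩ := exists_nat_gt ((δ - s 0) / η)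
  rw [div_lt_iff₀ hη] at hk'
  linarith [hk k, hδ k]

/-- The error is kept to half the main term, so the displacement lies between `1/4` and `3/4` of
`|c| * |x| ^ m`; the second bound makes it small relative to `|x|`. -/
theorem HasExpansion.exists_radius {C : ℝ → ℝ} {c : ℝ} {m : ℕ} (h : HasExpansion C c m)
    (hm : 2 ≤ m) (hc : c ≠ 0) : ∃ δ > 0, ∀ x : ℝ, |x| < δ →
      |C x - (x + c / 2 * x ^ m)| ≤ |c| / 4 * |x| ^ m ∧ |c| * |x| ^ m ≤ |x| / 2 := by
  have hc' : 0 < |c| := abs_pos.2 hc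
  have h1 : (fun x : ℝ => C x - (x + c / 2 * x ^ m)) =o[𝓝 0] fun x : ℝ => x ^ m :=
    h.trans_isLittleO (isLittleO_pow_pow (by omega))
  have h2 : (fun x : ℝ => x ^ m) =o[𝓝 0] fun x : ℝ => x ^ 1 := isLittleO_pow_pow (by omega)
  have h3 := (h1.def (c := |c| / 4) (by positivity)).and
    (h2.def (c := 1 / (2 * |c|)) (by positivity))
  obtain ⟨δ, hδ, hδ'⟩ := Metric.eventually_nhds_iff.1 h3
  refine ⟨δ, hδ, fun x hx => ?_⟩
  obtain ⟨h4, h5⟩ := hδ' (y := x) (by simpa [Real.dist_eq] using hx)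
  simp only [Real.norm_eq_abs, abs_pow, pow_one] at h4 h5
  refine ⟨h4, ?_⟩
  calc |c| * |x| ^ m ≤ |c| * (1 / (2 * |c|) * |x|) := by gcongr
    _ = |x| / 2 := by field_simp

/-- The sign of `c` decides whether orbits of `C` or of its inverse decay; those in the other
direction grow by a fixed amount per step and cannot stay local. The statement covers all `δ ≤ δ₀`
so that both half-axes can later share a radius. -/
theorem HasExpansion.orbits_of_pos {C : ℝ → ℝ} {c : ℝ} {m : ℕ} (h : HasExpansion C c m)
    (hm : 2 ≤ m) (hc : c ≠ 0) (hcont : ∀ᶠ x in 𝓝 (0 : ℝ), ContinuousAt C x) :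
    ∃ δ₀ > 0, ∀ δ > 0, δ ≤ δ₀ → ∀ x₀ : ℝ, 0 < x₀ → x₀ < δ →
      (∃ s : ℕ → ℝ, s 0 = x₀ ∧ IsLocalOrbit C δ s) ∧
      (∀ s : ℕ → ℝ, s 0 = x₀ → IsLocalOrbit C δ s → HasBoxDim (range s) (1 - 1 / (m : ℝ))) ∧
      (c < 0 → ∀ k : ℕ, |C^[k] x₀| < δ) := by
  obtain ⟨δ₁, hδ₁, hrad⟩ := h.exists_radius hm hc
  obtain ⟨δ₂, hδ₂, hcont⟩ := Metric.eventually_nhds_iff.1 hcont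
  refine ⟨min δ₁ δ₂, lt_min hδ₁ hδ₂, fun δ hδ hle x₀ hx₀ hx₀δ => ?_⟩
  have hle₁ : δ ≤ δ₁ := hle.trans (min_le_left _ _)
  have hle₂ : δ ≤ δ₂ := hle.trans (min_le_right _ _)
  have hc' : 0 < |c| := abs_pos.2 hc
  -- Here `3 / 8` is `(1 / 4 + 1 / 2) * (1 / 2)`. Any factor below `1` makes `C` preserve the sign
  -- of `x`, which keeps forward and inverse orbits on one side.
  have hnear : ∀ x, |x| < δ → |C x - x| ≤ 3 / 8 * |x| := by
    intro x hx
    obtain ⟨h1, h2⟩ := hrad x (hx.trans_le hle₁)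
    have h3 : |C x - x| ≤ |C x - (x + c / 2 * x ^ m)| + |c / 2 * x ^ m| := by
      have := abs_add_le (C x - (x + c / 2 * x ^ m)) (c / 2 * x ^ m)
      rwa [show C x - (x + c / 2 * x ^ m) + c / 2 * x ^ m = C x - x by ring] at this
    have h4 : |c / 2 * x ^ m| = |c| * |x| ^ m / 2 := by
      rw [abs_mul, abs_div, abs_pow, abs_two]; ring
    linarith
  have hpos : ∀ x, 0 < x → x < δ → 0 < C x := by
    intro x hx hxδ
    have := hnear x (by rwa [abs_of_pos hx])
    rw [abs_of_pos hx, abs_le] at this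
    linarith
  have hnonpos : ∀ x, |x| < δ → 0 < C x → 0 < x := by
    intro x hx hC
    by_contra! hx0
    have := hnear x hx
    rw [abs_of_nonpos hx0, abs_le] at this
    linarith
  have hzero : C 0 = 0 := by
    have := hnear 0 (by simpa using hδ)
    simpa using this
  have hgap : ∀ x, 0 < x → x < δ → |C x - (x + c / 2 * x ^ m)| ≤ |c| / 4 * x ^ m := by
    intro x hx hxδ
    have := (hrad x (by rw [abs_of_pos hx]; linarith)).1
    rwa [abs_of_pos hx] at this
  have hsmall : ∀ x, 0 < x → x < δ → |c| * x ^ m ≤ x / 2 := by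
    intro x hx hxδ
    have := (hrad x (by rw [abs_of_pos hx]; linarith)).2
    rwa [abs_of_pos hx] at this
  have horbit : ∀ s : ℕ → ℝ, s 0 = x₀ → IsLocalOrbit C δ s → ∀ k, 0 < s k ∧ s k < δ := by
    intro s hs0 hs k
    have hlt := fun k => (le_abs_self _).trans_lt (hs.1 k)
    refine ⟨?_, hlt k⟩
    induction k with
    | zero => rwa [hs0]
    | succ k ih =>
      rcases hs.2 with h | h
      · rw [h k]; exact hpos _ ih (hlt k)
      · exact hnonpos _ (hs.1 _) (by rwa [h k])
  rcases lt_or_gt_of_ne hc with hneg | hcpos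
  · -- attracting side
    have hac : |c| = -c := abs_of_neg hneg
    have hlo : ∀ x, 0 < x → x < δ → |c| / 4 * x ^ m ≤ x - C x := by
      intro x hx hxδ
      have := (abs_le.1 (hgap x hx hxδ)).2
      rw [hac] at this ⊢
      linarith
    have hhi : ∀ x, 0 < x → x < δ → x - C x ≤ |c| * x ^ m := by
      intro x hx hxδ
      have := (abs_le.1 (hgap x hx hxδ)).1
      have hp : 0 ≤ |c| * x ^ m := by positivity
      rw [hac] at this hp ⊢
      linarith
    have hiter : ∀ k : ℕ, 0 < C^[k] x₀ ∧ C^[k] x₀ < δ := by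
      intro k
      induction k with
      | zero => exact ⟨hx₀, hx₀δ⟩
      | succ k ih =>
        rw [Function.iterate_succ_apply']
        have := hlo _ ih.1 ih.2
        have hp : 0 ≤ |c| / 4 * (C^[k] x₀) ^ m := by have := ih.1; positivity
        exact ⟨hpos _ ih.1 ih.2, by linarith [ih.2]⟩
    have hiter' : ∀ k : ℕ, |C^[k] x₀| < δ := fun k => by
      rw [abs_of_pos (hiter k).1]; exact (hiter k).2
    refine ⟨⟨fun k => C^[k] x₀, rfl, hiter', Or.inl fun k => Function.iterate_succ_apply' _ _ _⟩,
      fun s hs0 hs => ?_, fun _ => hiter'⟩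
    have hs' := horbit s hs0 hs
    rcases hs.2 with hf | hb
    · refine hasBoxDim_range_of_decay hm (fun k => (hs' k).1) (A := |c| / 4) (B := |c|)
        (by positivity) hc' ?_ ?_ ?_
      · intro k; rw [hf k]; exact hlo _ (hs' k).1 (hs' k).2
      · intro k; rw [hf k]; exact hhi _ (hs' k).1 (hs' k).2
      · intro k
        have := hhi _ (hs' k).1 (hs' k).2
        have := hsmall _ (hs' k).1 (hs' k).2
        rw [hf k]; linarith
    · exfalso
      have hstep : ∀ k, s k + |c| / 4 * s (k + 1) ^ m ≤ s (k + 1) := fun k => by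
        have := hlo _ (hs' (k + 1)).1 (hs' (k + 1)).2
        rw [hb k] at this; linarith
      have hmono : Monotone s := monotone_nat_of_le_succ fun k => by
        have := hstep k
        have : 0 ≤ |c| / 4 * s (k + 1) ^ m := by have := (hs' (k + 1)).1; positivity
        linarith
      refine not_bddAbove_of_growth (η := |c| / 4 * x₀ ^ m) (by positivity) (fun k => ?_)
        (fun k => (hs' k).2)
      refine le_trans ?_ (hstep k)
      have : x₀ ≤ s (k + 1) := hs0 ▸ hmono (Nat.zero_le _)
      gcongr
  · -- repelling side
    have hac : |c| = c := abs_of_pos hcpos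
    have hlo : ∀ x, 0 < x → x < δ → |c| / 4 * x ^ m ≤ C x - x := by
      intro x hx hxδ
      have := (abs_le.1 (hgap x hx hxδ)).1
      rw [hac] at this ⊢
      linarith
    have hhi : ∀ x, 0 < x → x < δ → C x - x ≤ |c| * x ^ m := by
      intro x hx hxδ
      have := (abs_le.1 (hgap x hx hxδ)).2
      have hp : 0 ≤ |c| * x ^ m := by positivity
      rw [hac] at this hp ⊢
      linarith
    refine ⟨?_, fun s hs0 hs => ?_, fun hneg => absurd hneg hcpos.not_gt⟩
    -- Inverse orbits come from the intermediate value theorem on `[0, y]`, since `C 0 = 0` and `y ≤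
    -- C y`; injectivity of `C` is not needed.
    · have hinv : ∀ y, ∃ x, 0 < y → y < δ → 0 < x ∧ x < δ ∧ C x = y := by
        intro y
        by_cases hy : 0 < y ∧ y < δ
        · have hco : ContinuousOn C (Icc 0 y) := fun x hx =>
            (hcont (y := x) (by
              rw [Real.dist_eq, sub_zero, abs_of_nonneg hx.1]
              linarith [hx.2, hy.2])).continuousWithinAt
          have hCy : y ≤ C y := by
            have := hlo y hy.1 hy.2
            have hp : 0 ≤ |c| / 4 * y ^ m := by have := hy.1; positivity
            linarith
          obtain ⟨x, hx, hxy⟩ := intermediate_value_Icc hy.1.le hco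
            (show y ∈ Icc (C 0) (C y) from ⟨by rw [hzero]; exact hy.1.le, hCy⟩)
          refine ⟨x, fun _ _ => ⟨lt_of_le_of_ne hx.1 ?_, hx.2.trans_lt hy.2, hxy⟩⟩
          rintro rfl
          rw [hzero] at hxy
          exact hy.1.ne hxy
        · exact ⟨0, fun h1 h2 => absurd ⟨h1, h2⟩ hy⟩
      choose g hg using hinv
      have hiter : ∀ k : ℕ, 0 < g^[k] x₀ ∧ g^[k] x₀ < δ := by
        intro k
        induction k with
        | zero => exact ⟨hx₀, hx₀δ⟩
        | succ k ih =>
          rw [Function.iterate_succ_apply']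
          exact ⟨(hg _ ih.1 ih.2).1, (hg _ ih.1 ih.2).2.1⟩
      refine ⟨fun k => g^[k] x₀, rfl, fun k => ?_, Or.inr fun k => ?_⟩
      · rw [abs_of_pos (hiter k).1]; exact (hiter k).2
      · simp only [Function.iterate_succ_apply']
        exact (hg _ (hiter k).1 (hiter k).2).2.2
    have hs' := horbit s hs0 hs
    rcases hs.2 with hf | hb
    · exfalso
      have hstep : ∀ k, s k + |c| / 4 * s k ^ m ≤ s (k + 1) := fun k => by
        have := hlo _ (hs' k).1 (hs' k).2
        rw [hf k]; linarith
      have hmono : Monotone s := monotone_nat_of_le_succ fun k => by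
        have := hstep k
        have : 0 ≤ |c| / 4 * s k ^ m := by have := (hs' k).1; positivity
        linarith
      refine not_bddAbove_of_growth (η := |c| / 4 * x₀ ^ m) (by positivity) (fun k => ?_)
        (fun k => (hs' k).2)
      refine le_trans ?_ (hstep k)
      have : x₀ ≤ s k := hs0 ▸ hmono (Nat.zero_le _)
      gcongr
    · have hlo' : ∀ k, |c| / 4 * s (k + 1) ^ m ≤ s k - s (k + 1) := fun k => by
        have := hlo _ (hs' (k + 1)).1 (hs' (k + 1)).2
        rwa [hb k] at this
      have hhi' : ∀ k, s k - s (k + 1) ≤ |c| * s (k + 1) ^ m := fun k => by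
        have := hhi _ (hs' (k + 1)).1 (hs' (k + 1)).2
        rwa [hb k] at this
      have hhalf : ∀ k, s k ≤ 2 * s (k + 1) := fun k => by
        have := hsmall _ (hs' (k + 1)).1 (hs' (k + 1)).2
        linarith [hhi' k, (hs' (k + 1)).1]
      -- Gaps of an inverse orbit are controlled by `s (k + 1) ^ m`; passing to `s k ^ m` through `s
      -- k ≤ 2 * s (k + 1)` costs `2 ^ m`.
      refine hasBoxDim_range_of_decay hm (fun k => (hs' k).1) (A := |c| / 4 / 2 ^ m) (B := |c|)
        (by positivity) hc' (fun k => ?_) (fun k => ?_) hhalf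
      · refine le_trans ?_ (hlo' k)
        have h1 : s k ^ m ≤ (2 * s (k + 1)) ^ m := pow_le_pow_left₀ (hs' k).1.le (hhalf k) m
        calc |c| / 4 / 2 ^ m * s k ^ m ≤ |c| / 4 / 2 ^ m * (2 * s (k + 1)) ^ m := by gcongr
          _ = |c| / 4 * s (k + 1) ^ m := by rw [mul_pow]; field_simp
      · refine (hhi' k).trans ?_
        have h1 := hlo' k
        have h2 := (hs' (k + 1)).1
        have h3 : 0 ≤ |c| / 4 * s (k + 1) ^ m := by positivity
        have h4 : s (k + 1) ≤ s k := by linarith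
        gcongr

/-- Conjugation by `x ↦ -x` transfers the positive half-axis results to the negative one. -/
theorem HasExpansion.neg_conj {C : ℝ → ℝ} {c : ℝ} {m : ℕ} (h : HasExpansion C c m) :
    HasExpansion (fun x => -C (-x)) ((-1) ^ (m + 1) * c) m := by
  have ht : Tendsto (fun x : ℝ => -x) (𝓝 0) (𝓝 0) := by
    simpa using (continuous_neg (G := ℝ)).tendsto 0
  have h1 := (h.comp_tendsto ht).neg_left
  refine (h1.congr_left fun x => ?_).trans (IsBigO.of_bound 1 (Eventually.of_forall fun x => ?_))
  · simp only [Function.comp]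
    rw [neg_pow x m, pow_succ]; ring
  · simp

theorem HasExpansion.orbits {C : ℝ → ℝ} {c : ℝ} {m : ℕ} (h : HasExpansion C c m)
    (hm : 2 ≤ m) (hc : c ≠ 0) (hcont : ∀ᶠ x in 𝓝 (0 : ℝ), ContinuousAt C x) :
    ∃ δ > 0, ∀ x₀ : ℝ, x₀ ≠ 0 → |x₀| < δ →
      (∃ s : ℕ → ℝ, s 0 = x₀ ∧ IsLocalOrbit C δ s) ∧
      (∀ s : ℕ → ℝ, s 0 = x₀ → IsLocalOrbit C δ s → HasBoxDim (range s) (1 - 1 / (m : ℝ))) ∧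
      (c < 0 → (-1) ^ (m + 1) * c < 0 → ∀ k : ℕ, |C^[k] x₀| < δ) := by
  have ht : Tendsto (fun x : ℝ => -x) (𝓝 0) (𝓝 0) := by
    simpa using (continuous_neg (G := ℝ)).tendsto 0
  obtain ⟨δ₁, hδ₁, h₁⟩ := h.orbits_of_pos hm hc hcont
  obtain ⟨δ₂, hδ₂, h₂⟩ := h.neg_conj.orbits_of_pos hm
    (mul_ne_zero (pow_ne_zero _ (by norm_num)) hc)
    ((ht.eventually hcont).mono fun x hx => (hx.comp continuous_neg.continuousAt).neg)
  have hδ : 0 < min δ₁ δ₂ := lt_min hδ₁ hδ₂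
  refine ⟨min δ₁ δ₂, hδ, fun x₀ hx₀ hx₀δ => ?_⟩
  rcases lt_or_gt_of_ne hx₀ with hneg | hpos
  · have hconj : ∀ {D : ℝ → ℝ} {δ : ℝ} {s : ℕ → ℝ}, IsLocalOrbit D δ s →
        IsLocalOrbit (fun x => -D (-x)) δ (fun k => -s k) := by
      rintro D δ s ⟨h1, h2⟩
      refine ⟨fun k => by simpa using h1 k, h2.imp (fun h k => ?_) (fun h k => ?_)⟩
      · simp [h k]
      · simp [h k]
    obtain ⟨⟨s, hs0, hs⟩, hall, hfwd⟩ := h₂ _ hδ (min_le_right _ _) (-x₀) (by linarith)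
      (by rwa [abs_of_neg hneg] at hx₀δ)
    refine ⟨⟨fun k => -s k, by simp [hs0], by simpa using hconj hs⟩, fun t ht0 ht => ?_,
      fun _ hlt k => ?_⟩
    · have hd := (hall (fun k => -t k) (by simp [ht0]) (hconj ht)).neg
      have : -range (fun k => -t k) = range t := by
        ext y
        simp only [Set.mem_neg, mem_range, neg_inj]
      rwa [this] at hd
    · have hit : ∀ k : ℕ, (fun x => -C (-x))^[k] (-x₀) = -(C^[k] x₀) := by
        intro k
        induction k with
        | zero => rfl
        | succ k ih => rw [Function.iterate_succ_apply', Function.iterate_succ_apply', ih]; simp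
      have := hfwd hlt k
      rwa [hit, abs_neg] at this
  · obtain ⟨hex, hall, hfwd⟩ := h₁ _ hδ (min_le_left _ _) x₀ hpos
      (by rwa [abs_of_pos hpos] at hx₀δ)
    exact ⟨hex, hall, fun hlt _ => hfwd hlt⟩

theorem HasExpansion.hasCharBoxDim {C : ℝ → ℝ} {c : ℝ} {m : ℕ} (h : HasExpansion C c m)
    (hm : 2 ≤ m) (hc : c ≠ 0) (hcont : ∀ᶠ x in 𝓝 (0 : ℝ), ContinuousAt C x) :
    HasCharBoxDim C (1 - 1 / (m : ℝ)) := by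
  obtain ⟨δ, hδ, h⟩ := h.orbits hm hc hcont
  exact ⟨δ, hδ, fun x₀ hx₀ hlt => ⟨(h x₀ hx₀ hlt).1, (h x₀ hx₀ hlt).2.1⟩⟩

theorem HasExpansion.hasForwardCharBoxDim {C : ℝ → ℝ} {c : ℝ} {m : ℕ} (h : HasExpansion C c m)
    (hm : 2 ≤ m) (hc : c < 0) (hc' : (-1) ^ (m + 1) * c < 0)
    (hcont : ∀ᶠ x in 𝓝 (0 : ℝ), ContinuousAt C x) :
    HasForwardCharBoxDim C (1 - 1 / (m : ℝ)) := by
  obtain ⟨δ, hδ, h⟩ := h.orbits hm hc.ne hcont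
  refine ⟨δ, hδ, fun x₀ hx₀ hlt => ?_⟩
  obtain ⟨-, hall, hfwd⟩ := h x₀ hx₀ hlt
  exact ⟨hfwd hc hc', hall _ rfl ⟨hfwd hc hc', Or.inl fun k => Function.iterate_succ_apply' _ _ _⟩⟩

/-! ### Existence, uniqueness and continuity of the unit-time map. -/

section Flow

variable {V : ℝ × ℝ → ℝ × ℝ} {W W' : Set (ℝ × ℝ)} {I : Set ℝ} {γ γ₁ γ₂ : ℝ → ℝ × ℝ}

theorem IsSolutionIn.mono (h : IsSolutionIn V W I γ) (hW : W ⊆ W') : IsSolutionIn V W' I γ :=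
  fun t ht => ⟨hW (h t ht).1, (h t ht).2⟩

theorem IsSolutionIn.continuousOn (h : IsSolutionIn V W I γ) : ContinuousOn γ I :=
  fun t ht => (h t ht).2.continuousWithinAt

theorem IsSolutionIn.hasDerivWithinAt_Ici (h : IsSolutionIn V W (Icc 0 1) γ) {t : ℝ}
    (ht : t ∈ Ico (0 : ℝ) 1) : HasDerivWithinAt γ (V (γ t)) (Ici t) t :=
  (h t (Ico_subset_Icc_self ht)).2.mono_of_mem_nhdsWithin (Icc_mem_nhdsGE_of_mem ht)

theorem IsSolutionIn.dist_le {K : NNReal} (hV : LipschitzOnWith K V W)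
    (h₁ : IsSolutionIn V W (Icc 0 1) γ₁) (h₂ : IsSolutionIn V W (Icc 0 1) γ₂) {t : ℝ}
    (ht : t ∈ Icc (0 : ℝ) 1) : dist (γ₁ t) (γ₂ t) ≤ dist (γ₁ 0) (γ₂ 0) * Real.exp K := by
  have := dist_le_of_trajectories_ODE_of_mem (v := fun _ => V) (s := fun _ => W)
    (fun _ _ => hV) h₁.continuousOn (fun _ ht => h₁.hasDerivWithinAt_Ici ht)
    (fun t ht => (h₁ t (Ico_subset_Icc_self ht)).1) h₂.continuousOn
    (fun _ ht => h₂.hasDerivWithinAt_Ici ht)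
    (fun t ht => (h₂ t (Ico_subset_Icc_self ht)).1) le_rfl t ht
  refine this.trans ?_
  gcongr
  rw [sub_zero]
  exact mul_le_of_le_one_right K.2 ht.2

/-- Picard–Lindelöf must reach time `1` in a single step: with Lipschitz constant `1 / 2` the speed
on the ball of radius `a` is at most `a / 2`, so a start within `a / 2` does not leave it. -/
theorem eventually_exists_isSolutionIn (h0 : V 0 = 0) (hV : ContDiffAt ℝ 1 V 0)
    (hnorm : ‖fderiv ℝ V 0‖ < 1 / 2) (hW : W ∈ 𝓝 0) :
    ∀ᶠ z in 𝓝 (0 : ℝ × ℝ), ∃ γ : ℝ → ℝ × ℝ, γ 0 = z ∧ IsSolutionIn V W (Icc 0 1) γ := by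
  obtain ⟨T, hT, hLip⟩ := hV.exists_lipschitzOnWith_of_nnnorm_lt (1 / 2)
    (by rw [← NNReal.coe_lt_coe]; simpa using hnorm)
  obtain ⟨a, ha, hsub⟩ := Metric.nhds_basis_closedBall.mem_iff.1 (inter_mem hT hW)
  lift a to NNReal using ha.le
  have ha' : (0 : ℝ) < a := ha
  have hLip' : LipschitzOnWith (1 / 2) V (Metric.closedBall 0 a) :=
    hLip.mono (hsub.trans inter_subset_left)
  have hbound : ∀ z ∈ Metric.closedBall (0 : ℝ × ℝ) a, ‖V z‖ ≤ ((a / 2 : NNReal) : ℝ) := by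
    intro z hz
    have := hLip'.dist_le_mul z hz 0 (Metric.mem_closedBall_self ha'.le)
    rw [h0, dist_zero_right, dist_zero_right] at this
    have hz' : ‖z‖ ≤ a := by simpa using hz
    push_cast at this ⊢
    linarith
  have hPL : IsPicardLindelof (fun _ => V) (tmin := 0) (tmax := 1)
      ⟨0, by simp⟩ 0 a (a / 2) (a / 2) (1 / 2) :=
    IsPicardLindelof.of_time_independent hbound hLip' (by push_cast; norm_num; linarith)
  filter_upwards [Metric.closedBall_mem_nhds (0 : ℝ × ℝ) (half_pos ha')] with z hz
  have hz' : z ∈ Metric.closedBall (0 : ℝ × ℝ) ((a / 2 : NNReal) : ℝ) := by push_cast; exact hz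
  obtain ⟨α, hα⟩ := ODE.FunSpace.exists_isFixedPt_next hPL hz'
  have hmem : ∀ t, α.compProj t ∈ Metric.closedBall (0 : ℝ × ℝ) a := fun t =>
    α.compProj_mem_closedBall hPL.mul_max_le
  refine ⟨α.compProj, ?_, fun t ht => ⟨(hsub (hmem t)).2, ?_⟩⟩
  · have := ODE.FunSpace.compProj_val (α := α) (t := ⟨0, by simp⟩)
    rw [← hα, ODE.FunSpace.next_apply₀, hα] at this
    exact this
  · refine (ODE.hasDerivWithinAt_picard_Icc (f := fun _ => V) (t₀ := 0) (by simp) hPL.continuousOn_uncurry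
      α.continuous_compProj.continuousOn (fun t _ => hmem t) z ht).congr_of_mem (fun t' ht' => ?_) ht
    nth_rw 1 [← hα]
    rw [ODE.FunSpace.compProj_of_mem ht', ODE.FunSpace.next_apply]

/-- One `U` must serve every `W`. Uniqueness inside the fixed `W'` makes the endpoint independent of
the trajectory chosen. -/
theorem exists_isUnitTimeMap {K : NNReal} (hW' : W' ∈ 𝓝 0) (hV : LipschitzOnWith K V W')
    (hex : ∀ W ∈ 𝓝 (0 : ℝ × ℝ), ∀ᶠ z in 𝓝 (0 : ℝ × ℝ),
      ∃ γ : ℝ → ℝ × ℝ, γ 0 = z ∧ IsSolutionIn V W (Icc 0 1) γ) :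
    ∃ U, IsUnitTimeMap V U := by
  have hchoice : ∀ z, ∃ u : ℝ × ℝ, ∀ γ : ℝ → ℝ × ℝ, γ 0 = z → IsSolutionIn V W' (Icc 0 1) γ →
      γ 1 = u := by
    intro z
    by_cases h : ∃ γ : ℝ → ℝ × ℝ, γ 0 = z ∧ IsSolutionIn V W' (Icc 0 1) γ
    · obtain ⟨γ, hγ0, hγ⟩ := h
      refine ⟨γ 1, fun γ' hγ'0 hγ' => ?_⟩
      have := IsSolutionIn.dist_le hV hγ' hγ (right_mem_Icc.2 zero_le_one)
      rw [hγ0, hγ'0, dist_self, zero_mul] at this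
      exact dist_le_zero.1 this
    · exact ⟨0, fun γ h0 hγ => absurd ⟨γ, h0, hγ⟩ h⟩
  choose U hU using hchoice
  refine ⟨U, fun W hW => (hex _ (inter_mem hW hW')).mono ?_⟩
  rintro z ⟨γ, hγ0, hγ⟩
  exact ⟨γ, hγ0, hU z γ hγ0 (hγ.mono inter_subset_right), hγ.mono inter_subset_left⟩

theorem IsUnitTimeMap.eventually_continuousAt {K : NNReal} {U : ℝ × ℝ → ℝ × ℝ}
    (hU : IsUnitTimeMap V U) (hW : W ∈ 𝓝 0) (hV : LipschitzOnWith K V W) :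
    ∀ᶠ z in 𝓝 (0 : ℝ × ℝ), ContinuousAt U z := by
  refine (hU W hW).eventually_nhds.mono fun z hz => ?_
  have hL : LipschitzOnWith (Real.toNNReal (Real.exp K)) U
      {z | ∃ γ : ℝ → ℝ × ℝ, γ 0 = z ∧ γ 1 = U z ∧ IsSolutionIn V W (Icc 0 1) γ} := by
    refine LipschitzOnWith.of_dist_le_mul ?_
    rintro z₁ ⟨γ₁, h₁, h₁', hs₁⟩ z₂ ⟨γ₂, h₂, h₂', hs₂⟩
    have := IsSolutionIn.dist_le hV hs₁ hs₂ (right_mem_Icc.2 zero_le_one)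
    rw [h₁, h₁', h₂, h₂'] at this
    rw [Real.coe_toNNReal _ (Real.exp_pos _).le, mul_comm]
    exact this
  exact hL.continuousOn.continuousAt hz

end Flow

/-! ### The linear part and local solvability of the system. -/

section System

variable {X Y : ℝ × ℝ → ℝ} {p : ℝ → ℝ}

theorem system_zero (hp0 : p 0 = 0) : system X Y p 0 = 0 := by
  simp [system, hp0]

theorem analyticAt_system (hX : AnalyticAt ℝ X 0) (hY : AnalyticAt ℝ Y 0)
    (hp : AnalyticAt ℝ p 0) : AnalyticAt ℝ (system X Y p) 0 := by
  have h1 : AnalyticAt ℝ (fun z : ℝ × ℝ => z.1) 0 := analyticAt_fst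
  have h2 : AnalyticAt ℝ (fun z : ℝ × ℝ => z.2) 0 := analyticAt_snd
  have h3 : AnalyticAt ℝ (fun z : ℝ × ℝ => p z.1) 0 :=
    AnalyticAt.fun_comp (g := p) (f := fun z : ℝ × ℝ => z.1) hp h1
  exact (h2.mul hX).prod (h3.add (h2.mul hY))

theorem hasFDerivAt_system (hX : DifferentiableAt ℝ X 0) (hY : DifferentiableAt ℝ Y 0)
    (hp : DifferentiableAt ℝ p 0) (hp1 : deriv p 0 = 0) :
    HasFDerivAt (system X Y p) ((ContinuousLinearMap.snd ℝ ℝ ℝ).smulRight (X 0, Y 0)) 0 := by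
  have h2 : HasFDerivAt (fun z : ℝ × ℝ => z.2) (ContinuousLinearMap.snd ℝ ℝ ℝ) 0 := hasFDerivAt_snd
  have h1 : HasFDerivAt (fun z : ℝ × ℝ => z.1) (ContinuousLinearMap.fst ℝ ℝ ℝ) 0 := hasFDerivAt_fst
  have h3 : HasFDerivAt (fun z : ℝ × ℝ => p z.1) ((0 : ℝ) • ContinuousLinearMap.fst ℝ ℝ ℝ) 0 :=
    HasDerivAt.comp_hasFDerivAt (h₂ := p) (f := fun z : ℝ × ℝ => z.1) 0
      (by simpa [hp1] using hp.hasDerivAt) h1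
  refine ((h2.mul hX.hasFDerivAt).prodMk (h3.add (h2.mul hY.hasFDerivAt))).congr_fderiv ?_
  ext <;> simp

/-- `L` sends `(X 0, Y 0)` to `Y 0` times itself, so nilpotency makes `Y 0` vanish; then `X 0 = 0`
would give `L = 0`. -/
theorem IsNilpotentSingularity.system_coeffs (hX : DifferentiableAt ℝ X 0)
    (hY : DifferentiableAt ℝ Y 0) (hp : DifferentiableAt ℝ p 0) (hp1 : deriv p 0 = 0)
    (h : IsNilpotentSingularity (system X Y p)) : X 0 ≠ 0 ∧ Y 0 = 0 := by
  obtain ⟨-, -, ⟨n, hn⟩, hne⟩ := h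
  rw [(hasFDerivAt_system hX hY hp hp1).fderiv] at hn hne
  set L := (ContinuousLinearMap.snd ℝ ℝ ℝ).smulRight (X 0, Y 0) with hL
  have hpow : ∀ k : ℕ, (L ^ k) (X 0, Y 0) = Y 0 ^ k • (X 0, Y 0) := by
    intro k
    induction k with
    | zero => simp
    | succ k ih =>
      rw [pow_succ', mul_apply_eq_comp, ih, map_smul, pow_succ, mul_smul]
      simp [hL]
  have hY0 : Y 0 = 0 := by
    have := congrArg Prod.snd (hpow n)
    rw [hn] at this
    have h' : Y 0 ^ (n + 1) = 0 := by
      rw [pow_succ]; simpa using this.symm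
    exact pow_eq_zero_iff (by omega) |>.1 h'
  refine ⟨fun hX0 => hne ?_, hY0⟩
  rw [hL, hX0, hY0]
  ext <;> simp

/-- Replacing `y` by `M * y` preserves the form of the system and shrinks its linear part to norm at
most `|X 0| / M < 1 / 2`; `S` maps solutions back. -/
theorem eventually_exists_isSolutionIn_system (hX : AnalyticAt ℝ X 0) (hY : AnalyticAt ℝ Y 0)
    (hp : AnalyticAt ℝ p 0) (hp0 : p 0 = 0) (hp1 : deriv p 0 = 0) (hY0 : Y 0 = 0)
    {W : Set (ℝ × ℝ)} (hW : W ∈ 𝓝 0) :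
    ∀ᶠ z in 𝓝 (0 : ℝ × ℝ), ∃ γ : ℝ → ℝ × ℝ,
      γ 0 = z ∧ IsSolutionIn (system X Y p) W (Icc 0 1) γ := by
  set M : ℝ := 2 * |X 0| + 1 with hM
  have hM0 : 0 < M := by positivity
  set S : ℝ × ℝ →L[ℝ] ℝ × ℝ :=
    (ContinuousLinearMap.fst ℝ ℝ ℝ).prod (M⁻¹ • ContinuousLinearMap.snd ℝ ℝ ℝ) with hS
  have hS' : ∀ z, S z = (z.1, M⁻¹ * z.2) := fun z => by simp [hS]
  have hS0 : S 0 = 0 := map_zero S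
  have hSa : AnalyticAt ℝ S 0 := S.analyticAt 0
  set X' : ℝ × ℝ → ℝ := fun z => M⁻¹ * X (S z) with hX'
  set Y' : ℝ × ℝ → ℝ := fun z => Y (S z) with hY'
  set p' : ℝ → ℝ := fun x => M * p x with hp'
  have hXa : AnalyticAt ℝ X' 0 :=
    analyticAt_const.mul (AnalyticAt.fun_comp (g := X) (f := S) (by rwa [hS0]) hSa)
  have hYa : AnalyticAt ℝ Y' 0 := AnalyticAt.fun_comp (g := Y) (f := S) (by rwa [hS0]) hSa
  have hpa : AnalyticAt ℝ p' 0 := analyticAt_const.mul hp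
  have hp1' : deriv p' 0 = 0 := by
    rw [hp', deriv_const_mul _ hp.differentiableAt, hp1, mul_zero]
  have hnorm : ‖fderiv ℝ (system X' Y' p') 0‖ < 1 / 2 := by
    rw [(hasFDerivAt_system hXa.differentiableAt hYa.differentiableAt hpa.differentiableAt
      hp1').fderiv, ContinuousLinearMap.norm_smulRight_apply]
    have h1 : ‖(X' 0, Y' 0)‖ = M⁻¹ * |X 0| := by
      simp only [hX', hY', hS0, hY0, Prod.norm_def, norm_zero, norm_mul, norm_inv,
        Real.norm_eq_abs, abs_of_pos hM0]
      exact max_eq_left (by positivity)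
    have h2 := ContinuousLinearMap.norm_snd_le ℝ ℝ ℝ
    rw [h1]
    calc ‖ContinuousLinearMap.snd ℝ ℝ ℝ‖ * (M⁻¹ * |X 0|) ≤ 1 * (M⁻¹ * |X 0|) := by gcongr
      _ = |X 0| / M := by ring
      _ < 1 / 2 := by rw [div_lt_div_iff₀ hM0 two_pos, hM]; linarith
  have hW' : S ⁻¹' W ∈ 𝓝 0 := hSa.continuousAt.preimage_mem_nhds (by rwa [hS0])
  have hex := eventually_exists_isSolutionIn (system_zero (X := X') (Y := Y') (p := p')
    (by simp [hp', hp0])) (analyticAt_system hXa hYa hpa).contDiffAt hnorm hW'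
  have ht : Tendsto (fun z : ℝ × ℝ => (z.1, M * z.2)) (𝓝 0) (𝓝 0) := by
    have : Continuous fun z : ℝ × ℝ => (z.1, M * z.2) := by fun_prop
    simpa [← Prod.mk_zero_zero] using this.tendsto 0
  filter_upwards [ht.eventually hex] with z hz
  obtain ⟨γ, hγ0, hγ⟩ := hz
  refine ⟨fun t => S (γ t), ?_, fun t ht => ⟨(hγ t ht).1, ?_⟩⟩
  · simp [hγ0, hS', hM0.ne']
  · refine (S.hasFDerivAt.comp_hasDerivWithinAt t (hγ t ht).2).congr_deriv ?_
    rw [hS' (system X' Y' p' (γ t))]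
    simp only [system, hX', hY', hp', hS']
    ext
    · simp; ring
    · simp; field_simp

end System

/-- A map that is twice continuously differentiable differs from its linear part by a map whose
Lipschitz constant on the ball of radius `r` is `O(r)`. -/
theorem exists_remainder_lipschitz {E F : Type*} [NormedAddCommGroup E] [NormedSpace ℝ E]
    [NormedAddCommGroup F] [NormedSpace ℝ F] {V : E → F} (hV : ContDiffAt ℝ 2 V 0) :
    ∃ D > 0, ∃ r₀ > 0, ∀ r < r₀, ∀ z ∈ Metric.closedBall (0 : E) r,
      ∀ w ∈ Metric.closedBall (0 : E) r,
      ‖V w - V z - fderiv ℝ V 0 (w - z)‖ ≤ D * r * ‖w - z‖ := by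
  have hd : DifferentiableAt ℝ (fderiv ℝ V) 0 :=
    (hV.fderiv_right (m := 1) (by norm_num)).differentiableAt (by norm_num)
  obtain ⟨D, hD, hbound⟩ := hd.isBigO_sub.exists_pos
  have hdiff : ∀ᶠ z in 𝓝 (0 : E), DifferentiableAt ℝ V z :=
    (hV.eventually (by simp)).mono fun z hz => hz.differentiableAt (by norm_num)
  obtain ⟨r₀, hr₀, h⟩ := Metric.eventually_nhds_iff.1 (hbound.bound.and hdiff)
  refine ⟨D, hD, r₀, hr₀, fun r hr z hz w hw => ?_⟩
  have hmem : ∀ y ∈ Metric.closedBall (0 : E) r, dist y 0 < r₀ := fun y hy =>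
    (Metric.mem_closedBall.1 hy).trans_lt hr
  refine (convex_closedBall (0 : E) r).norm_image_sub_le_of_norm_fderiv_le'
    (fun y hy => (h (hmem y hy)).2) (fun y hy => ?_) hz hw
  refine (h (hmem y hy)).1.trans ?_
  rw [sub_zero]
  have : ‖y‖ ≤ r := by simpa using hy
  gcongr

/-! ### Second-order expansion of the unit-time map on the axis. -/

section Expansion

variable {X Y : ℝ × ℝ → ℝ} {p : ℝ → ℝ}

/-- The error must carry the factor `p x`, so `V` is compared with its value `(0, p x)` at the
starting point. The trajectory stays in a ball of radius `O(|x|)` and moves by `O(|p x|)`, so the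
nonlinear remainder is `O(|x| * |p x|)`; two integrations follow. -/
theorem isBigO_unitTimeMap_fst (hX : AnalyticAt ℝ X 0) (hY : AnalyticAt ℝ Y 0)
    (hp : AnalyticAt ℝ p 0) (hp0 : p 0 = 0) (hp1 : deriv p 0 = 0) (hY0 : Y 0 = 0)
    {U : ℝ × ℝ → ℝ × ℝ} (hU : IsUnitTimeMap (system X Y p) U) :
    (fun x : ℝ => (U (x, 0)).1 - x - X 0 / 2 * p x) =O[𝓝 0] fun x => x * p x := by
  set V := system X Y p with hV
  have hV0 : V 0 = 0 := system_zero hp0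
  have hL := hasFDerivAt_system hX.differentiableAt hY.differentiableAt hp.differentiableAt hp1
  obtain ⟨D, hD, r₀, hr₀, hrem⟩ :=
    exists_remainder_lipschitz (analyticAt_system hX hY hp).contDiffAt
  rw [hL.fderiv] at hrem
  obtain ⟨K, W, hW, hLip⟩ :=
    ((analyticAt_system hX hY hp).contDiffAt (n := 1)).exists_lipschitzOnWith
  rw [← hV] at hLip hrem
  -- A strictly positive constant, because the Grönwall bound divides by it.
  set K' : ℝ := K + 1
  have hK' : 0 < K' := by positivity
  set G : ℝ := Real.exp K' / K' with hG
  have hG0 : 0 < G := by positivity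
  set e : ℝ := Real.exp K with he
  have he1 : 1 ≤ e := Real.one_le_exp K.2
  have hcurve : Tendsto (fun x : ℝ => ((x, 0) : ℝ × ℝ)) (𝓝 0) (𝓝 0) := by
    have : Continuous fun x : ℝ => ((x, 0) : ℝ × ℝ) := by fun_prop
    simpa [← Prod.mk_zero_zero] using this.tendsto 0
  refine IsBigO.of_bound ((|X 0| + 1) * (D * e * G)) ?_
  filter_upwards [hcurve.eventually (hU W hW), hcurve.eventually hW,
    Metric.ball_mem_nhds (0 : ℝ) (show 0 < r₀ / e by positivity)] with x hx hxW hxr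
  obtain ⟨γ, hγ0, hγ1, hγ⟩ := hx
  rw [← hγ1]
  have hxr' : e * |x| < r₀ := by
    rw [mem_ball_zero_iff, Real.norm_eq_abs, lt_div_iff₀ (by positivity)] at hxr
    linarith
  have hnx : ‖((x, 0) : ℝ × ℝ)‖ = |x| := by simp [Prod.norm_def]
  have hVx : V (x, 0) = (0, p x) := by simp [hV, system]
  have hzero : IsSolutionIn V W (Icc 0 1) (fun _ => 0) := fun t _ =>
    ⟨mem_of_mem_nhds hW, by rw [hV0]; exact hasDerivWithinAt_const _ _ _⟩
  have hball : ∀ t ∈ Icc (0 : ℝ) 1, γ t ∈ Metric.closedBall (0 : ℝ × ℝ) (e * |x|) := by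
    intro t ht
    have := IsSolutionIn.dist_le hLip hγ hzero ht
    rw [hγ0, dist_zero_right, dist_zero_right, hnx] at this
    simpa [mul_comm] using this
  have hxball : ((x, 0) : ℝ × ℝ) ∈ Metric.closedBall (0 : ℝ × ℝ) (e * |x|) := by
    rw [mem_closedBall_zero_iff, hnx]
    exact le_mul_of_one_le_left (abs_nonneg x) he1
  have hdisp : ∀ t ∈ Icc (0 : ℝ) 1, ‖γ t - (x, 0)‖ ≤ |p x| * G := by
    intro t ht
    have hgr := norm_le_gronwallBound_of_norm_deriv_right_le (f := fun t => γ t - (x, 0))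
      (f' := fun t => V (γ t)) (δ := 0) (K := K') (ε := |p x|) (a := 0) (b := 1)
      (hγ.continuousOn.sub continuousOn_const)
      (fun t ht => (hγ.hasDerivWithinAt_Ici ht).sub_const _) (by simp [hγ0])
      (fun t ht => by
        have h1 := hLip.norm_sub_le (hγ t (Ico_subset_Icc_self ht)).1 hxW
        have h2 := norm_le_norm_add_norm_sub' (V (γ t)) (V (x, 0))
        have h3 : ‖V (x, 0)‖ = |p x| := by rw [hVx]; simp [Prod.norm_def]
        have h4 : (K : ℝ) * ‖γ t - (x, 0)‖ ≤ K' * ‖γ t - (x, 0)‖ := by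
          gcongr; simp [K']
        linarith) t ht
    refine hgr.trans ?_
    rw [gronwallBound_of_K_ne_0 hK'.ne']
    simp only [sub_zero, zero_mul, zero_add]
    rw [hG, ← mul_div_assoc, div_mul_eq_mul_div]
    gcongr
    have : Real.exp (K' * t) ≤ Real.exp K' :=
      Real.exp_le_exp.2 (mul_le_of_le_one_right hK'.le ht.2)
    linarith
  set η : ℝ := D * e * G * (|x| * |p x|) with hη
  have hη0 : 0 ≤ η := by positivity
  have hR : ∀ t ∈ Icc (0 : ℝ) 1,
      |(V (γ t)).1 - X 0 * (γ t).2| ≤ η ∧ |(V (γ t)).2 - p x| ≤ η := by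
    intro t ht
    have h1 := hrem _ hxr' _ hxball _ (hball t ht)
    have h2 : D * (e * |x|) * ‖γ t - (x, 0)‖ ≤ η := by
      calc _ ≤ D * (e * |x|) * (|p x| * G) := by gcongr; exact hdisp t ht
        _ = η := by rw [hη]; ring
    have h3 := h1.trans h2
    rw [hVx] at h3
    refine ⟨le_trans ?_ ((norm_fst_le _).trans h3), le_trans ?_ ((norm_snd_le _).trans h3)⟩
    · simp [mul_comm]
    · simp [hY0]
  have hfst : ∀ t ∈ Icc (0 : ℝ) 1,
      HasDerivWithinAt (fun t => (γ t).1) (V (γ t)).1 (Icc 0 1) t := fun t ht =>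
    (ContinuousLinearMap.fst ℝ ℝ ℝ).hasFDerivAt.comp_hasDerivWithinAt t (hγ t ht).2
  have hsnd : ∀ t ∈ Icc (0 : ℝ) 1,
      HasDerivWithinAt (fun t => (γ t).2) (V (γ t)).2 (Icc 0 1) t := fun t ht =>
    (ContinuousLinearMap.snd ℝ ℝ ℝ).hasFDerivAt.comp_hasDerivWithinAt t (hγ t ht).2
  have hy : ∀ t ∈ Icc (0 : ℝ) 1, |(γ t).2 - p x * t| ≤ η := by
    intro t ht
    have := norm_image_sub_le_of_norm_deriv_le_segment' (f := fun t => (γ t).2 - p x * t)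
      (f' := fun t => (V (γ t)).2 - p x) (C := η) (a := 0) (b := 1)
      (fun t ht => ((hsnd t ht).sub
        ((hasDerivWithinAt_id t (Icc 0 1)).const_mul (p x))).congr_deriv (by simp))
      (fun t ht => (hR t (Ico_subset_Icc_self ht)).2) t ht
    simp only [hγ0, Real.norm_eq_abs, mul_zero, sub_zero] at this
    refine this.trans (mul_le_of_le_one_right hη0 ht.2)
  have hx1 := norm_image_sub_le_of_norm_deriv_le_segment_01'
    (f := fun t => (γ t).1 - X 0 * p x / 2 * t ^ 2)
    (f' := fun t => (V (γ t)).1 - X 0 * p x * t) (C := (|X 0| + 1) * η)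
    (fun t ht => by
      refine ((hfst t ht).sub
        (((hasDerivWithinAt_id t (Icc 0 1)).pow 2).const_mul (X 0 * p x / 2))).congr_deriv ?_
      simp; ring)
    (fun t ht => by
      have ht' := Ico_subset_Icc_self ht
      have h1 : (V (γ t)).1 - X 0 * p x * t
          = ((V (γ t)).1 - X 0 * (γ t).2) + X 0 * ((γ t).2 - p x * t) := by ring
      rw [Real.norm_eq_abs, h1]
      refine (abs_add_le _ _).trans ?_
      rw [abs_mul]
      have h2 := (hR t ht').1
      have h3 : |X 0| * |(γ t).2 - p x * t| ≤ |X 0| * η := by gcongr; exact hy t ht'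
      linarith)
  simp only [hγ0, Real.norm_eq_abs] at hx1 ⊢
  rw [abs_mul]
  calc |(γ 1).1 - x - X 0 / 2 * p x|
      = |(γ 1).1 - X 0 * p x / 2 * 1 ^ 2 - (x - X 0 * p x / 2 * 0 ^ 2)| := by congr 1; ring
    _ ≤ (|X 0| + 1) * η := hx1
    _ = _ := by rw [hη]; ring

end Expansion

/-! ### A node has no repelling half-axis. -/

section Node

variable {X Y : ℝ × ℝ → ℝ} {p : ℝ → ℝ}

/-- On a half-axis `σ x > 0` on which `X 0 * p` has the sign of `σ`, trajectories starting on the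
axis move away from the origin. -/
theorem IsStableNode.not_repelling (hnode : IsStableNode (system X Y p)) (hX : ContinuousAt X 0)
    (hX0 : X 0 ≠ 0) {σ : ℝ} (hσ : σ * σ = 1) :
    ¬ ∀ᶠ x in 𝓝[>] (0 : ℝ), 0 < σ * X 0 * p (σ * x) := by
  intro hrep
  obtain ⟨ρ, hρ, hrep⟩ := (mem_nhdsGT_iff_exists_Ioo_subset).1 hrep
  have hρ' : (0 : ℝ) < ρ := hρ
  have habs : |σ| = 1 := by
    have : |σ| * |σ| = 1 := by rw [← abs_mul, hσ, abs_one]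
    nlinarith [abs_nonneg σ]
  have hXW : ∀ᶠ z in 𝓝 (0 : ℝ × ℝ), 0 < X z * X 0 := by
    have : ContinuousAt (fun z => X z * X 0) 0 := hX.mul_const _
    exact this.eventually (lt_mem_nhds (mul_self_pos.2 hX0))
  have hball : ∀ᶠ z in 𝓝 (0 : ℝ × ℝ), |z.1| < ρ := by
    have : ContinuousAt (fun z : ℝ × ℝ => |z.1|) 0 := by fun_prop
    exact this.eventually (gt_mem_nhds (by simpa using hρ'))
  have hcurve : Tendsto (fun x : ℝ => ((σ * x, 0) : ℝ × ℝ)) (𝓝[>] 0) (𝓝 0) := by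
    have : Continuous fun x : ℝ => ((σ * x, 0) : ℝ × ℝ) := by fun_prop
    have := this.tendsto 0
    simp only [mul_zero, Prod.mk_zero_zero] at this
    exact this.mono_left nhdsWithin_le_nhds
  obtain ⟨x₀, ⟨γ, hγ0, hγ, hlim, -⟩, hx₀⟩ :=
    ((hcurve.eventually (hnode _ (hXW.and hball))).and self_mem_nhdsWithin).exists
  have hx₀ : 0 < x₀ := hx₀
  -- `ξ` is the position along the half-axis, and `ζ ≤ 0` says that `y` has the sign that pushes `ξ`
  -- outward.
  set ξ : ℝ → ℝ := fun t => σ * (γ t).1 with hξ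
  set ζ : ℝ → ℝ := fun t => -(σ * X 0 * (γ t).2) with hζ
  have hξ0 : ξ 0 = x₀ := by simp only [hξ, hγ0, ← mul_assoc, hσ, one_mul]
  have hderiv : ∀ t, 0 ≤ t → HasDerivWithinAt γ (system X Y p (γ t)) (Ici t) t := fun t ht =>
    (hγ t ht).2.mono (Ici_subset_Ici.2 ht)
  have hξd : ∀ t, 0 ≤ t → HasDerivWithinAt ξ (σ * ((γ t).2 * X (γ t))) (Ici t) t := fun t ht =>
    ((ContinuousLinearMap.fst ℝ ℝ ℝ).hasFDerivAt.comp_hasDerivWithinAt t (hderiv t ht)).const_mul σ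
  have hζd : ∀ t, 0 ≤ t →
      HasDerivWithinAt ζ (-(σ * X 0 * (p (γ t).1 + (γ t).2 * Y (γ t)))) (Ici t) t := fun t ht =>
    (((ContinuousLinearMap.snd ℝ ℝ ℝ).hasFDerivAt.comp_hasDerivWithinAt t
      (hderiv t ht)).const_mul (σ * X 0)).neg
  have hcont : ContinuousOn γ (Ici 0) := fun t ht => (hγ t ht).2.continuousWithinAt
  have hξc : ContinuousOn ξ (Ici 0) := continuousOn_const.mul hcont.fst
  have hζc : ContinuousOn ζ (Ici 0) := (continuousOn_const.mul hcont.snd).neg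
  have hξlim : Tendsto ξ atTop (𝓝 0) := by
    simpa using ((continuous_fst.tendsto (0 : ℝ × ℝ)).comp hlim).const_mul σ
  obtain ⟨T₁, hT₁, hT₁0⟩ :=
    ((hξlim.eventually (gt_mem_nhds (half_pos hx₀))).and (eventually_ge_atTop 0)).exists
  have hsubIcc : ∀ T : ℝ, Icc 0 T ⊆ Ici 0 := fun T t ht => ht.1
  -- The first time `ξ` has dropped to `x₀ / 2`. Before it, `ξ` lies in `(0, ρ)`, where the sign of
  -- `p` is known; this will force `ξ T ≥ x₀`.
  obtain ⟨T, ⟨hTmem, hTle⟩, hTmin⟩ : ∃ T, IsLeast (Icc 0 T₁ ∩ ξ ⁻¹' Iic (x₀ / 2)) T := by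
    refine IsCompact.exists_isLeast ?_ ⟨T₁, ⟨hT₁0, le_rfl⟩, hT₁.le⟩
    exact isCompact_Icc.of_isClosed_subset
      ((hξc.mono (hsubIcc T₁)).preimage_isClosed_of_isClosed isClosed_Icc isClosed_Iic)
      inter_subset_left
  have hTle : ξ T ≤ x₀ / 2 := hTle
  have hbefore : ∀ t ∈ Ico 0 T, x₀ / 2 < ξ t := by
    intro t ht
    by_contra! h
    exact ht.2.not_ge (hTmin ⟨⟨ht.1, ht.2.le.trans hTmem.2⟩, h⟩)
  have hγσ : ∀ t, (γ t).1 = σ * ξ t := fun t => by simp only [hξ, ← mul_assoc, hσ, one_mul]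
  have hp : ∀ t ∈ Ico 0 T, 0 < σ * X 0 * p (γ t).1 := by
    intro t ht
    rw [hγσ]
    refine hrep ⟨(half_pos hx₀).trans (hbefore t ht), ?_⟩
    calc ξ t ≤ |ξ t| := le_abs_self _
      _ = |(γ t).1| := by rw [hξ, abs_mul, habs, one_mul]
      _ < ρ := (hγ t ht.1).1.2
  have hζ_nonpos : ∀ ⦃t⦄, t ∈ Icc 0 T → ζ t ≤ 0 :=
    image_le_of_deriv_right_lt_deriv_boundary (B := fun _ => 0) (B' := fun _ => 0)
      (hζc.mono (hsubIcc T)) (fun t ht => hζd t ht.1) (by simp [hζ, hγ0])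
      -- Barrier argument: when `ζ = 0` the `Y` term drops out and `p` makes the derivative of `ζ`
      -- strictly negative.
      (fun t => hasDerivAt_const _ _) (fun t ht hzero => by
        have hσ0 : σ ≠ 0 := by rintro rfl; simp at hσ
        have h2 : (γ t).2 = 0 := by simpa [hζ, hσ0, hX0] using hzero
        rw [h2, zero_mul, add_zero]
        exact neg_neg_of_pos (hp t ht))
  have hξ_ge : ∀ ⦃t⦄, t ∈ Icc 0 T → x₀ ≤ ξ t :=
    image_le_of_deriv_right_le_deriv_boundary (f := fun _ => x₀) (f' := fun _ => 0)
      continuousOn_const (fun t _ => hasDerivWithinAt_const _ _ _) hξ0.ge (hξc.mono (hsubIcc T))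
      (fun t ht => hξd t ht.1) (fun t ht => by
        have h1 : 0 ≤ σ * X 0 * (γ t).2 := by
          have := hζ_nonpos (Ico_subset_Icc_self ht)
          simp only [hζ] at this
          linarith
        have h2 : 0 < X (γ t) * X 0 := (hγ t ht.1).1.1
        have h3 : 0 ≤ (σ * ((γ t).2 * X (γ t))) * (X 0 * X 0) := by
          calc (0 : ℝ) ≤ (σ * X 0 * (γ t).2) * (X (γ t) * X 0) := mul_nonneg h1 h2.le
            _ = _ := by ring
        exact nonneg_of_mul_nonneg_left h3 (mul_self_pos.2 hX0))
  linarith [hξ_ge (right_mem_Icc.2 hTmem.1)]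

theorem neg_system : (fun z => -system X Y p z) =
    system (fun z => -X z) (fun z => -Y z) (fun x => -p x) := by
  ext z
  · simp [system]
  · simp [system]; ring

/-- Time reversal changes the sign of both `X 0` and `p`, so the repelling condition is unaffected
and the unstable case reduces to the stable one. -/
theorem IsNode.not_repelling (hnode : IsNode (system X Y p)) (hX : ContinuousAt X 0)
    (hX0 : X 0 ≠ 0) {σ : ℝ} (hσ : σ * σ = 1) :
    ¬ ∀ᶠ x in 𝓝[>] (0 : ℝ), 0 < σ * X 0 * p (σ * x) := by
  rcases hnode.2 with h | h
  · exact h.not_repelling hX hX0 hσ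
  · rw [neg_system] at h
    have := h.not_repelling hX.neg (neg_ne_zero.2 hX0) hσ
    simpa using this

theorem IsNode.leadingCoeff_neg (hnode : IsNode (system X Y p)) (hX : ContinuousAt X 0)
    (hX0 : X 0 ≠ 0) {g : ℝ → ℝ} {m : ℕ} (hg : ContinuousAt g 0) (hg0 : g 0 ≠ 0)
    (hpg : ∀ᶠ x in 𝓝 (0 : ℝ), p x = x ^ m * g x) {σ : ℝ} (hσ : σ * σ = 1) :
    σ ^ (m + 1) * (X 0 * g 0) < 0 := by
  have hσ0 : σ ≠ 0 := by rintro rfl; simp at hσ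
  by_contra! hle
  have hlt : 0 < σ ^ (m + 1) * (X 0 * g 0) := lt_of_le_of_ne hle (by positivity)
  refine hnode.not_repelling hX hX0 hσ ?_
  have ht : Tendsto (fun x : ℝ => σ * x) (𝓝 0) (𝓝 0) := by
    simpa using (continuous_const_mul σ).tendsto 0
  have hev : ∀ᶠ x in 𝓝 (0 : ℝ), 0 < σ ^ (m + 1) * (X 0 * g x) :=
    ((hg.const_mul (X 0)).const_mul (σ ^ (m + 1))).eventually (lt_mem_nhds hlt)
  filter_upwards [mem_nhdsWithin_of_mem_nhds (ht.eventually hpg),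
    mem_nhdsWithin_of_mem_nhds (ht.eventually hev), self_mem_nhdsWithin] with x h1 h2 hx
  have hx : 0 < x := hx
  have h1 : p (σ * x) = (σ * x) ^ m * g (σ * x) := h1
  have h2 : 0 < σ ^ (m + 1) * (X 0 * g (σ * x)) := h2
  rw [h1]
  calc (0 : ℝ) < x ^ m * (σ ^ (m + 1) * (X 0 * g (σ * x))) := by positivity
    _ = _ := by ring

end Node

/-! ### The characteristic curve, its map, and the multiplicity. -/

section Characteristic

variable {X Y : ℝ × ℝ → ℝ} {p : ℝ → ℝ}

theorem isCharacteristicCurve_zero : IsCharacteristicCurve (system X Y p) fun _ => 0 :=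
  ⟨rfl, contDiffAt_const, Eventually.of_forall fun x => by simp [system]⟩

theorem IsCharacteristicCurve.eventually_eq_zero {f : ℝ → ℝ}
    (hf : IsCharacteristicCurve (system X Y p) f) (hX : ContinuousAt X 0) (hX0 : X 0 ≠ 0) :
    ∀ᶠ x in 𝓝 (0 : ℝ), f x = 0 := by
  obtain ⟨hf0, hfc, hf⟩ := hf
  have ht : Tendsto (fun x => (x, f x)) (𝓝 0) (𝓝 (0 : ℝ × ℝ)) := by
    have : ContinuousAt (fun x => (x, f x)) 0 := continuousAt_id.prodMk hfc.continuousAt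
    simpa only [ContinuousAt, id, hf0, Prod.mk_zero_zero] using this
  filter_upwards [hf, ht.eventually (hX.eventually_ne hX0)] with x h1 h2
  exact (mul_eq_zero.1 h1).resolve_right h2

/-- If `p` vanished near `0`, the whole axis would consist of singular points, so `p` has finite
order; orders `0` and `1` are excluded by `hp0` and `hp1`. -/
theorem exists_eq_pow_mul (hp : AnalyticAt ℝ p 0) (hp0 : p 0 = 0) (hp1 : deriv p 0 = 0)
    (hiso : IsIsolatedSingularity (system X Y p)) :
    ∃ m : ℕ, 2 ≤ m ∧ ∃ g : ℝ → ℝ, AnalyticAt ℝ g 0 ∧ g 0 ≠ 0 ∧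
      ∀ᶠ x in 𝓝 (0 : ℝ), p x = x ^ m * g x := by
  have hne : ¬ ∀ᶠ x in 𝓝 (0 : ℝ), p x = 0 := by
    intro h
    have ht : Tendsto (fun x : ℝ => ((x, 0) : ℝ × ℝ)) (𝓝[≠] 0) (𝓝[≠] 0) := by
      refine tendsto_nhdsWithin_iff.2 ⟨?_, ?_⟩
      · have : Continuous fun x : ℝ => ((x, 0) : ℝ × ℝ) := by fun_prop
        have := this.tendsto 0
        rw [Prod.mk_zero_zero] at this
        exact this.mono_left nhdsWithin_le_nhds
      · filter_upwards [self_mem_nhdsWithin] with x hx h0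
        exact hx (congrArg Prod.fst h0)
    obtain ⟨x, h1, h2⟩ :=
      ((ht.eventually hiso.2).and (mem_nhdsWithin_of_mem_nhds h)).exists
    have h2 : p x = 0 := h2
    exact h1 (by simp [system, h2])
  obtain ⟨m, g, hg, hg0, hpg⟩ := hp.exists_eventuallyEq_pow_smul_nonzero_iff.2 hne
  simp only [sub_zero, smul_eq_mul] at hpg
  refine ⟨m, ?_, g, hg, hg0, hpg⟩
  by_contra! hlt
  interval_cases m
  · have := hpg.self_of_nhds
    simp only [pow_zero, one_mul, hp0] at this
    exact hg0 this.symm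
  · have h1 : HasDerivAt (fun x => x ^ 1 * g x) (g 0) 0 := by
      refine (((hasDerivAt_id (0 : ℝ)).pow 1).mul hg.differentiableAt.hasDerivAt).congr_deriv ?_
      simp
    exact hg0 ((h1.congr_of_eventuallyEq hpg).deriv.symm.trans hp1)

theorem isBigO_sub_leadingTerm {g : ℝ → ℝ} {m : ℕ} (hg : DifferentiableAt ℝ g 0)
    (hpg : ∀ᶠ x in 𝓝 (0 : ℝ), p x = x ^ m * g x) :
    (fun x => p x - g 0 * x ^ m) =O[𝓝 0] fun x : ℝ => x ^ (m + 1) := by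
  have h1 : (fun x => g x - g 0) =O[𝓝 0] fun x : ℝ => x := by simpa using hg.isBigO_sub
  refine ((isBigO_refl (fun x : ℝ => x ^ m) (𝓝 0)).mul h1).congr' ?_ ?_
  · filter_upwards [hpg] with x hx
    rw [hx]; ring
  · exact Eventually.of_forall fun x => (pow_succ x m).symm

theorem isMultipleSingularity_iff {a : ℝ} {m n : ℕ} (hX : ContinuousAt X 0) (hX0 : X 0 ≠ 0)
    (hp0 : p 0 = 0) (ha : a ≠ 0)
    (hpa : (fun x => p x - a * x ^ m) =O[𝓝 0] fun x : ℝ => x ^ (m + 1)) :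
    IsMultipleSingularity (system X Y p) n ↔ n = m := by
  constructor
  · rintro ⟨-, f, hf, b, hb, hO⟩
    refine leadingOrder_unique hb ha (hO.congr' ?_ EventuallyEq.rfl) hpa
    filter_upwards [hf.eventually_eq_zero hX hX0] with x hx
    simp [system, hx]
  · rintro rfl
    exact ⟨system_zero hp0, _, isCharacteristicCurve_zero, a, ha, by simpa [system] using hpa⟩

theorem exists_isCharacteristicMap (hX : AnalyticAt ℝ X 0) (hY : AnalyticAt ℝ Y 0)
    (hp : AnalyticAt ℝ p 0) (hp0 : p 0 = 0) (hp1 : deriv p 0 = 0) (hY0 : Y 0 = 0) :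
    ∃ C, IsCharacteristicMap (system X Y p) C := by
  obtain ⟨K, W, hW, hLip⟩ :=
    ((analyticAt_system hX hY hp).contDiffAt (n := 1)).exists_lipschitzOnWith
  obtain ⟨U, hU⟩ := exists_isUnitTimeMap hW hLip fun W hW =>
    eventually_exists_isSolutionIn_system hX hY hp hp0 hp1 hY0 hW
  exact ⟨fun x => (U (x, 0)).1, _, U, isCharacteristicCurve_zero, hU, Eventually.of_forall
    fun _ => rfl⟩

theorem IsCharacteristicMap.exists_unitTimeMap {C : ℝ → ℝ}
    (hC : IsCharacteristicMap (system X Y p) C) (hX : ContinuousAt X 0) (hX0 : X 0 ≠ 0) :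
    ∃ U, IsUnitTimeMap (system X Y p) U ∧ ∀ᶠ x in 𝓝 (0 : ℝ), C x = (U (x, 0)).1 := by
  obtain ⟨f, U, hf, hU, hC⟩ := hC
  refine ⟨U, hU, ?_⟩
  filter_upwards [hC, hf.eventually_eq_zero hX hX0] with x h1 h2
  rw [h1, h2]

theorem IsCharacteristicMap.eventually_continuousAt {C : ℝ → ℝ}
    (hC : IsCharacteristicMap (system X Y p) C) (hX : AnalyticAt ℝ X 0) (hY : AnalyticAt ℝ Y 0)
    (hp : AnalyticAt ℝ p 0) (hX0 : X 0 ≠ 0) : ∀ᶠ x in 𝓝 (0 : ℝ), ContinuousAt C x := by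
  obtain ⟨U, hU, hCU⟩ := hC.exists_unitTimeMap hX.continuousAt hX0
  obtain ⟨K, W, hW, hLip⟩ :=
    ((analyticAt_system hX hY hp).contDiffAt (n := 1)).exists_lipschitzOnWith
  have hcurve : Continuous fun x : ℝ => ((x, 0) : ℝ × ℝ) := by fun_prop
  have ht : Tendsto (fun x : ℝ => ((x, 0) : ℝ × ℝ)) (𝓝 0) (𝓝 0) := by
    simpa only [Prod.mk_zero_zero] using hcurve.tendsto 0
  filter_upwards [ht.eventually (hU.eventually_continuousAt hW hLip), hCU.eventually_nhds]
    with x h1 h2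
  have h3 : ContinuousAt (fun x : ℝ => U (x, 0)) x :=
    ContinuousAt.comp (g := U) (f := fun x : ℝ => ((x, 0) : ℝ × ℝ)) h1 hcurve.continuousAt
  exact h3.fst.congr (h2.mono fun y hy => hy.symm)

theorem IsCharacteristicMap.hasExpansion {C : ℝ → ℝ} {a : ℝ} {m : ℕ}
    (hC : IsCharacteristicMap (system X Y p) C) (hX : AnalyticAt ℝ X 0) (hY : AnalyticAt ℝ Y 0)
    (hp : AnalyticAt ℝ p 0) (hp0 : p 0 = 0) (hp1 : deriv p 0 = 0) (hX0 : X 0 ≠ 0) (hY0 : Y 0 = 0)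
    (hpa : (fun x => p x - a * x ^ m) =O[𝓝 0] fun x : ℝ => x ^ (m + 1)) :
    HasExpansion C (X 0 * a) m := by
  obtain ⟨U, hU, hCU⟩ := hC.exists_unitTimeMap hX.continuousAt hX0
  have hpO : p =O[𝓝 0] fun x : ℝ => x ^ m := by
    have h1 := hpa.trans (isLittleO_pow_pow (𝕜 := ℝ) (Nat.lt_succ_self m)).isBigO
    have h2 : (fun x : ℝ => a * x ^ m) =O[𝓝 0] fun x : ℝ => x ^ m :=
      isBigO_const_mul_self a _ _
    simpa using h1.add h2
  have h1 := (isBigO_unitTimeMap_fst hX hY hp hp0 hp1 hY0 hU).trans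
    (((isBigO_refl (fun x : ℝ => x) (𝓝 0)).mul hpO).congr_right fun x => (pow_succ' x m).symm)
  refine (h1.add (hpa.const_mul_left (X 0 / 2))).congr' ?_ EventuallyEq.rfl
  filter_upwards [hCU] with x hx
  rw [hx]; ring

theorem HasExpansion.exists_iff {C : ℝ → ℝ} {c : ℝ} {m n : ℕ} (h : HasExpansion C c m)
    (hc : c ≠ 0) : (∃ b : ℝ, b ≠ 0 ∧ HasExpansion C b n) ↔ n = m := by
  constructor
  · rintro ⟨b, hb, hb'⟩
    have key : ∀ {c : ℝ} {m : ℕ}, HasExpansion C c m →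
        (fun x => (C x - x) - c / 2 * x ^ m) =O[𝓝 0] fun x : ℝ => x ^ (m + 1) := fun h =>
      h.congr_left fun x => by ring
    exact leadingOrder_unique (by simpa using hb) (by simpa using hc) (key hb') (key h)
  · rintro rfl
    exact ⟨c, hc, h⟩

end Characteristic

theorem eq_of_one_sub_inv_eq {m n : ℕ} (h : 1 - 1 / (n : ℝ) = 1 - 1 / (m : ℝ)) : n = m := by
  have : (n : ℝ)⁻¹ = (m : ℝ)⁻¹ := by simpa using h
  exact_mod_cast inv_injective this

end NilpotentDim

theorem proposition4 (X Y : ℝ × ℝ → ℝ) (p : ℝ → ℝ)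
    (hX : AnalyticAt ℝ X 0) (hY : AnalyticAt ℝ Y 0) (hp : AnalyticAt ℝ p 0)
    (hp0 : p 0 = 0) (hp1 : deriv p 0 = 0)
    (hnil : NilpotentDim.IsNilpotentSingularity (NilpotentDim.system X Y p))
    (hiso : NilpotentDim.IsIsolatedSingularity (NilpotentDim.system X Y p)) :
    (∃ C : ℝ → ℝ, NilpotentDim.IsCharacteristicMap (NilpotentDim.system X Y p) C) ∧
    ∀ C : ℝ → ℝ, NilpotentDim.IsCharacteristicMap (NilpotentDim.system X Y p) C →
      (∃ m : ℕ, 2 ≤ m ∧ ∃ c : ℝ, c ≠ 0 ∧ NilpotentDim.HasExpansion C c m ∧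
        NilpotentDim.HasCharBoxDim C (1 - 1 / (m : ℝ))) ∧
      (∀ m : ℕ, 1 ≤ m →
        ((∃ c : ℝ, c ≠ 0 ∧ NilpotentDim.HasExpansion C c m) ↔
          NilpotentDim.IsMultipleSingularity (NilpotentDim.system X Y p) m) ∧
        (NilpotentDim.HasCharBoxDim C (1 - 1 / (m : ℝ)) ↔
          NilpotentDim.IsMultipleSingularity (NilpotentDim.system X Y p) m)) ∧
      (NilpotentDim.IsNode (NilpotentDim.system X Y p) → ∀ m : ℕ, 1 ≤ m →
        ((∃ c : ℝ, c ≠ 0 ∧ NilpotentDim.HasExpansion C c m) ↔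
          NilpotentDim.IsMultipleNode (NilpotentDim.system X Y p) m) ∧
        (NilpotentDim.HasForwardCharBoxDim C (1 - 1 / (m : ℝ)) ↔
          NilpotentDim.IsMultipleNode (NilpotentDim.system X Y p) m)) := by
  obtain ⟨hX0, hY0⟩ := hnil.system_coeffs hX.differentiableAt hY.differentiableAt
    hp.differentiableAt hp1
  obtain ⟨m₀, hm₀, g, hg, hg0, hpg⟩ := NilpotentDim.exists_eq_pow_mul hp hp0 hp1 hiso
  have hpa := NilpotentDim.isBigO_sub_leadingTerm hg.differentiableAt hpg
  have hc : X 0 * g 0 ≠ 0 := mul_ne_zero hX0 hg0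
  refine ⟨NilpotentDim.exists_isCharacteristicMap hX hY hp hp0 hp1 hY0, fun C hC => ?_⟩
  have hexp := hC.hasExpansion hX hY hp hp0 hp1 hX0 hY0 hpa
  have hcont := hC.eventually_continuousAt hX hY hp hX0
  have hdim := hexp.hasCharBoxDim hm₀ hc hcont
  have hsing : ∀ m, NilpotentDim.IsMultipleSingularity (NilpotentDim.system X Y p) m ↔ m = m₀ :=
    fun m => NilpotentDim.isMultipleSingularity_iff hX.continuousAt hX0 hp0 hg0 hpa
  have hmap : ∀ m, (∃ c : ℝ, c ≠ 0 ∧ NilpotentDim.HasExpansion C c m) ↔ m = m₀ :=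
    fun m => hexp.exists_iff hc
  refine ⟨⟨m₀, hm₀, _, hc, hexp, hdim⟩, fun m _ => ⟨(hmap m).trans (hsing m).symm, ?_⟩,
    fun hnode m _ => ?_⟩
  · rw [hsing]
    refine ⟨fun h => NilpotentDim.eq_of_one_sub_inv_eq (h.unique hdim), ?_⟩
    rintro rfl
    exact hdim
  -- The values `σ = 1` and `σ = -1` give attraction from the right and from the left.
  · have hneg : ∀ σ : ℝ, σ * σ = 1 → σ ^ (m₀ + 1) * (X 0 * g 0) < 0 := fun σ hσ =>
      hnode.leadingCoeff_neg hX.continuousAt hX0 hg.continuousAt hg0 hpg hσ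
    have hfwd := hexp.hasForwardCharBoxDim hm₀ (by simpa using hneg 1 (mul_one 1))
      (hneg (-1) (by norm_num)) hcont
    have hnode_iff : NilpotentDim.IsMultipleNode (NilpotentDim.system X Y p) m ↔ m = m₀ :=
      (and_iff_right hnode).trans (hsing m)
    rw [hnode_iff]
    refine ⟨hmap m, fun h => NilpotentDim.eq_of_one_sub_inv_eq (h.unique hfwd), ?_⟩
    rintro rfl
    exact hfwd
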